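/- Let $\mathbb{B}=\{z\in\mathbb{C}^n : \|z\|<1\}$ be the unit ball. For a real function $\varphi$ of class $C^2$ on $\mathbb{B}$, a point $z\in\mathbb{B}$ and $v\in\mathbb{C}^n$ let $$L_z(\varphi,v)=\sum_{k,l=1}^n\frac{\partial^2\varphi}{\partial z_k\,\partial\bar z_l}(z)\,v_k\bar v_l$$ be the Levi form. Let $K(z,\xi)=\sum_{\alpha}\phi_\alpha(z)\overline{\phi_\alpha(\xi)}$ be the Bergman kernel of $\mathbb{B}$, where $(\phi_\alpha)$ is a complete orthonormal system of the space of square integrable holomorphic functions on $\mathbb{B}$ (with respect to Lebesgue measure), and let $$ds^2(z,v)=\sum_{\mu,\nu=1}^n\frac{\partial^2\log K(z,z)}{\partial z_\mu\,\partial\bar z_\nu}\,v_\mu\bar v_\nu$$ be the Bergman metric. Let $\operatorname{Aut}(\mathbb{B})$ be the set of all holomorphic bijections $\mathbb{B}\to\mathbb{B}$. Let $f:\mathbb{B}\to\mathbb{C}$ be holomorphic, and suppose that there is a finite constant $C$ such that $$L_z\bigl(\log(1+|f|^2),v\bigr)\le C\cdot ds^2(z,v)\qquad\text{for all } z\in\mathbb{B},\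 v\in\mathbb{C}^n.$$ Then $f$ is normal, that is, the family $\{f\circ g : g\in\operatorname{Aut}(\mathbb{B})\}$ is a normal family of holomorphic functions on $\mathbb{B}$ in the sense of Montel: every sequence in it has a subsequence that either converges uniformly on every compact subset of $\mathbb{B}$ to a finite limit function, or converges to $\infty$ uniformly on every compact subset of $\mathbb{B}$. -/

import Mathlib

open MeasureTheory Filter Set
open scoped ComplexConjugate ENNReal

noncomputable section

/-- The complex Euclidean space `ℂⁿ` with its Euclidean norm and Lebesgue measure. -/
abbrev Cn (n : ℕ) : Type := EuclideanSpace ℂ (Fin n)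

/-- The open unit ball `𝔹` of `ℂⁿ`. -/
def unitBall (n : ℕ) : Set (Cn n) := Metric.ball 0 1

/-! ### Levi form -/

/-- The derivative `∂u/∂z_k = (∂u/∂x_k - i ∂u/∂y_k) / 2`, where `z_k = x_k + i y_k`. -/
def wirtinger {n : ℕ} (k : Fin n) (u : Cn n → ℂ) (z : Cn n) : ℂ :=
  (1 / 2) * (fderiv ℝ u z (EuclideanSpace.single k 1)
    - Complex.I * fderiv ℝ u z (EuclideanSpace.single k Complex.I))

/-- The derivative `∂u/∂z̄_k = (∂u/∂x_k + i ∂u/∂y_k) / 2`, where `z_k = x_k + i y_k`. -/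
def wirtingerBar {n : ℕ} (k : Fin n) (u : Cn n → ℂ) (z : Cn n) : ℂ :=
  (1 / 2) * (fderiv ℝ u z (EuclideanSpace.single k 1)
    + Complex.I * fderiv ℝ u z (EuclideanSpace.single k Complex.I))

/-- The Levi form `L_z(φ, v) = ∑_{k,l} ∂²φ/∂z_k∂z̄_l (z) v_k v̄_l` of a real function `φ`.
For `φ` of class `C²` near `z` the sum is a real number; the real part only changes its type. -/
def leviForm {n : ℕ} (φ : Cn n → ℝ) (z v : Cn n) : ℝ :=
  (∑ k, ∑ l, wirtinger k (wirtingerBar l (fun w => (φ w : ℂ))) z * v k * conj (v l)).re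

/-! ### Bergman kernel and Bergman metric -/

/-- The space of square integrable holomorphic functions on `Ω`. -/
def bergmanSpace {n : ℕ} (Ω : Set (Cn n)) : Submodule ℂ (Cn n → ℂ) where
  carrier := {f | DifferentiableOn ℂ f Ω ∧ MemLp f 2 (volume.restrict Ω)}
  zero_mem' := ⟨differentiableOn_const (0 : ℂ), MemLp.zero⟩
  add_mem' hf hg := ⟨hf.1.add hg.1, hf.2.add hg.2⟩
  smul_mem' c _ hf := ⟨hf.1.const_smul c, hf.2.const_smul c⟩

/-- The scalar product `(φ, ψ) = ∫_Ω φ ψ̄ dV`. -/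
def bergmanInner {n : ℕ} (Ω : Set (Cn n)) (φ ψ : Cn n → ℂ) : ℂ :=
  ∫ z in Ω, φ z * conj (ψ z)

/-- `S` is a complete orthonormal system for the space of square integrable holomorphic functions
on `Ω`: an orthonormal set whose linear span is dense for the `L²` norm. -/
structure IsCompleteOrthonormalSystem {n : ℕ} (Ω : Set (Cn n)) (S : Set (Cn n → ℂ)) : Prop where
  subset : S ⊆ bergmanSpace Ω
  unit : ∀ φ ∈ S, bergmanInner Ω φ φ = 1
  orthogonal : ∀ φ ∈ S, ∀ ψ ∈ S, φ ≠ ψ → bergmanInner Ω φ ψ = 0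
  complete : ∀ f ∈ bergmanSpace Ω, ∀ ε : ℝ≥0∞, 0 < ε →
    ∃ g ∈ Submodule.span ℂ S, eLpNorm (f - g) 2 (volume.restrict Ω) < ε

/-- The inclusion of the Bergman space in `L²(Ω)`. -/
def bergmanToLp {n : ℕ} (Ω : Set (Cn n)) :
    bergmanSpace Ω →ₗ[ℂ] Lp ℂ 2 (volume.restrict Ω) where
  toFun f := MemLp.toLp f.1 f.2.2
  map_add' f g := MemLp.toLp_add f.2.2 g.2.2
  map_smul' c f := MemLp.toLp_const_smul c f.2.2

theorem coeFn_bergmanToLp {n : ℕ} (Ω : Set (Cn n)) (f : bergmanSpace Ω) :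
    bergmanToLp Ω f =ᵐ[volume.restrict Ω] f.1 :=
  MemLp.coeFn_toLp f.2.2

theorem inner_bergmanToLp {n : ℕ} (Ω : Set (Cn n)) (f g : bergmanSpace Ω) :
    inner ℂ (bergmanToLp Ω g) (bergmanToLp Ω f) = bergmanInner Ω f.1 g.1 := by
  rw [L2.inner_def, bergmanInner]
  refine integral_congr_ae ?_
  filter_upwards [coeFn_bergmanToLp Ω f, coeFn_bergmanToLp Ω g] with x hf hg
  rw [hf, hg]
  simp

theorem exists_isCompleteOrthonormalSystem {n : ℕ} (Ω : Set (Cn n)) :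
    ∃ S : Set (Cn n → ℂ), IsCompleteOrthonormalSystem Ω S := by
  have : Fact ((2 : ℝ≥0∞) ≠ ∞) := ⟨by simp⟩
  obtain ⟨d, hdW, hd⟩ : ∃ d : ℕ → Lp ℂ 2 (volume.restrict Ω),
      (∀ i, d i ∈ LinearMap.range (bergmanToLp Ω)) ∧
      ∀ x ∈ LinearMap.range (bergmanToLp Ω), ∀ ε > 0, ∃ i, edist x (d i) < ε := by
    have : Nonempty (LinearMap.range (bergmanToLp Ω)) := ⟨0⟩
    refine ⟨fun i => (TopologicalSpace.denseSeq (LinearMap.range (bergmanToLp Ω)) i).1,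
      fun i => (TopologicalSpace.denseSeq (LinearMap.range (bergmanToLp Ω)) i).2, ?_⟩
    intro x hx ε hε
    obtain ⟨i, hi⟩ := (TopologicalSpace.denseRange_denseSeq
      (LinearMap.range (bergmanToLp Ω))).exists_mem_open
        (Metric.isOpen_eball (x := ⟨x, hx⟩) (ε := ε)) ⟨_, Metric.mem_eball_self hε⟩
    refine ⟨i, ?_⟩
    rw [edist_comm]
    exact hi
  obtain ⟨e, he⟩ : ∃ e, e = InnerProductSpace.gramSchmidtNormed ℂ d := ⟨_, rfl⟩
  have hspan : Submodule.span ℂ (range e) = Submodule.span ℂ (range d) := by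
    rw [he, InnerProductSpace.span_gramSchmidtNormed_range, InnerProductSpace.span_gramSchmidt]
  have heW : ∀ i, ∃ f : bergmanSpace Ω, bergmanToLp Ω f = e i := by
    intro i
    have h1 : e i ∈ Submodule.span ℂ (range d) := hspan ▸ Submodule.subset_span ⟨i, rfl⟩
    have h2 : Submodule.span ℂ (range d) ≤ LinearMap.range (bergmanToLp Ω) := by
      rw [Submodule.span_le]
      rintro _ ⟨j, rfl⟩
      exact hdW j
    exact h2 h1
  choose r hr using heW
  have horth := InnerProductSpace.gramSchmidtNormed_orthonormal' (𝕜 := ℂ) d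
  rw [← he] at horth
  refine ⟨{φ | ∃ i, e i ≠ 0 ∧ φ = (r i).1}, ?_, ?_, ?_, ?_⟩
  · rintro _ ⟨i, _, rfl⟩
    exact (r i).2
  · rintro _ ⟨i, hi, rfl⟩
    rw [← inner_bergmanToLp, hr, inner_self_eq_norm_sq_to_K]
    have h1 : ‖e i‖ = 1 := horth.1 ⟨i, hi⟩
    simp [h1]
  · rintro _ ⟨i, hi, rfl⟩ _ ⟨j, hj, rfl⟩ hij
    rw [← inner_bergmanToLp, hr, hr]
    have hne : (⟨j, hj⟩ : {i // e i ≠ 0}) ≠ ⟨i, hi⟩ := by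
      rintro h
      cases h
      exact hij rfl
    exact horth.2 hne
  · intro f hf ε hε
    obtain ⟨m, hm⟩ := hd (bergmanToLp Ω ⟨f, hf⟩) ⟨_, rfl⟩ ε hε
    have h2 : d m ∈ Submodule.map (bergmanToLp Ω)
        (Submodule.comap (bergmanSpace Ω).subtype
          (Submodule.span ℂ {φ | ∃ i, e i ≠ 0 ∧ φ = (r i).1})) := by
      have h3 : d m ∈ Submodule.span ℂ (range e) := hspan ▸ Submodule.subset_span ⟨m, rfl⟩
      refine (Submodule.span_le.2 ?_) h3
      rintro _ ⟨i, rfl⟩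
      by_cases hi : e i = 0
      · rw [hi]
        exact Submodule.zero_mem _
      · exact ⟨r i, Submodule.subset_span ⟨i, hi, rfl⟩, hr i⟩
    obtain ⟨g, hg, hgm⟩ := h2
    refine ⟨g.1, hg, ?_⟩
    rw [← hgm] at hm
    refine lt_of_eq_of_lt ?_ hm
    rw [Lp.edist_def]
    refine eLpNorm_congr_ae ?_
    filter_upwards [coeFn_bergmanToLp Ω ⟨f, hf⟩, coeFn_bergmanToLp Ω g] with x h4 h5
    simp only [Pi.sub_apply]
    rw [h4, h5]

/-- The Bergman kernel `K_Ω(z, ξ) = ∑_α φ_α(z) \overline{φ_α(ξ)}`, where `(φ_α)` is a complete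
orthonormal system for the space of square integrable holomorphic functions on `Ω` (for open `Ω`
the sum does not depend on the system). -/
def bergmanKernel {n : ℕ} (Ω : Set (Cn n)) (z ξ : Cn n) : ℂ :=
  ∑' φ : (exists_isCompleteOrthonormalSystem Ω).choose, φ.1 z * conj (φ.1 ξ)

/-- The Bergman metric `ds²(z, v) = ∑_{μ,ν} ∂² log K_Ω(z, z)/∂z_μ∂z̄_ν v_μ v̄_ν`.
(`K_Ω(z, z)` is a nonnegative real number.) -/
def bergmanMetric {n : ℕ} (Ω : Set (Cn n)) (z v : Cn n) : ℝ :=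
  leviForm (fun w => Real.log (bergmanKernel Ω w w).re) z v

/-! ### Normal families and normal functions -/

/-- `Aut(U)`: the holomorphic maps from `U` to `U` that are one-to-one and onto. Only the values
on `U` of the representing maps matter. -/
def holomorphicAut {n : ℕ} (U : Set (Cn n)) : Set (Cn n → Cn n) :=
  {g | DifferentiableOn ℂ g U ∧ BijOn g U U}

/-- A family of holomorphic functions on `Ω` is normal in the sense of Montel if every sequence in
it has a subsequence that converges, uniformly on every compact subset of `Ω`, either to a finite
limit function or to `∞`. -/
def IsNormalFamily {n : ℕ} (Ω : Set (Cn n)) (F : Set (Cn n → ℂ)) : Prop :=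
  (∀ f ∈ F, DifferentiableOn ℂ f Ω) ∧
  ∀ u : ℕ → Cn n → ℂ, (∀ j, u j ∈ F) → ∃ k : ℕ → ℕ, StrictMono k ∧
    ((∃ f : Cn n → ℂ, ∀ K ⊆ Ω, IsCompact K →
        TendstoUniformlyOn (fun j => u (k j)) f atTop K) ∨
      (∀ K ⊆ Ω, IsCompact K → ∀ M : ℝ, ∀ᶠ j in atTop, ∀ z ∈ K, M < ‖u (k j) z‖))

/-- A holomorphic function `f` on the unit ball is normal if `{f ∘ g : g ∈ Aut(𝔹)}` is a normal
family. -/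
def IsNormalFunction {n : ℕ} (f : Cn n → ℂ) : Prop :=
  DifferentiableOn ℂ f (unitBall n) ∧
    IsNormalFamily (unitBall n) {h | ∃ g ∈ holomorphicAut (unitBall n), h = f ∘ g}

end

/-! By Marty's criterion (`exists_subseq_of_spherical_derivative_le`) it suffices to bound the
spherical derivative ‖d(f∘g)‖ / (1 + |f∘g|²) locally uniformly on the ball, independently of g. The
Levi form of log(1 + |f|²) is exactly (|df(v)| / (1 + |f|²))² (`leviForm_log_one_add_norm_sq`), so
the hypothesis makes f Lipschitz from the Bergman metric to the spherical one. What is left is a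
bound on the Bergman length of dg(v) that does not depend on g: the Schwarz-Pick estimate
`bergmanMetric_fderiv_le`.

The metric is made explicit without computing an orthonormal basis. K(z,z) is the least M with
|F(z)|² ≤ M‖F‖² on the Bergman space (`sum_norm_sq_le`, `evalBound_tsum`), and weighted composition
with Möbius maps carries such bounds between 0 and w. Hence K(w,w) = c / (1 - ‖w‖²)^(n+1), and the
Bergman metric at z is n+1 times the squared norm of the image of v under the derivative of the
Möbius map taking z to 0. Schwarz-Pick then becomes a derivative estimate for a bounded map.

For Marty's criterion the functions are viewed as maps into a compact model of the Riemann sphere.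
Arzelà-Ascoli gives a limit, Hurwitz's argument applied to 1/F shows that the set where the limit is
∞ is open, and connectedness leaves only the two cases of the definition. -/

/-! ### Holomorphy of derivatives in several variables. -/

/-- A directional derivative of a holomorphic function of several variables is holomorphic. -/
theorem differentiableAt_fderiv_apply {E : Type*} [NormedAddCommGroup E] [NormedSpace ℂ E]
    [FiniteDimensional ℂ E] {f : E → ℂ} {U : Set E} (hU : IsOpen U)
    (hf : DifferentiableOn ℂ f U) {z : E} (hz : z ∈ U) (e : E) :
    DifferentiableAt ℂ (fun w => fderiv ℂ f w e) z := by
  let : MeasurableSpace E := borel E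
  have : BorelSpace E := ⟨rfl⟩
  have : ProperSpace E := FiniteDimensional.proper ℂ E
  obtain ⟨ε, hε, hεU⟩ := Metric.nhds_basis_closedBall.mem_iff.1 (hU.mem_nhds hz)
  obtain ⟨M, hM⟩ := (isCompact_closedBall z ε).exists_bound_of_continuousOn
    (hf.continuousOn.mono hεU)
  have hM0 : 0 ≤ M := (norm_nonneg _).trans (hM z (Metric.mem_closedBall_self hε.le))
  -- Discs of radius ρ in direction `e` then move points by at most ε/4; the `+ 1` covers `e = 0`.
  set ρ : ℝ := ε / (4 * (‖e‖ + 1)) with hρ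
  have hρ0 : 0 < ρ := by positivity
  have hρe : ρ * ‖e‖ ≤ ε / 4 := by
    rw [hρ, div_mul_eq_mul_div, div_le_div_iff₀ (by positivity) (by positivity)]
    nlinarith [norm_nonneg e]
  have hmem : ∀ w ∈ Metric.ball z (ε / 4), ∀ ζ : ℂ, ‖ζ‖ ≤ ρ →
      w + ζ • e ∈ Metric.ball z (ε / 2) := by
    intro w hw ζ hζ
    rw [mem_ball_iff_norm] at hw ⊢
    calc ‖w + ζ • e - z‖ = ‖(w - z) + ζ • e‖ := by congr 1; abel
      _ ≤ ‖w - z‖ + ‖ζ‖ * ‖e‖ := (norm_add_le _ _).trans_eq (by rw [norm_smul])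
      _ ≤ ‖w - z‖ + ρ * ‖e‖ := by gcongr
      _ < ε / 2 := by linarith
  have hsub : Metric.ball z (ε / 2) ⊆ U := fun x hx =>
    hεU (Metric.ball_subset_closedBall (Metric.ball_subset_ball (by linarith) hx))
  have hdiff : ∀ x ∈ U, HasFDerivAt f (fderiv ℂ f x) x := fun x hx =>
    (hf.differentiableAt (hU.mem_nhds hx)).hasFDerivAt
  have hbound : ∀ x ∈ Metric.ball z (ε / 2), ‖fderiv ℂ f x‖ ≤ 2 * M / (ε / 2) := by
    intro x hx
    have hxs : Metric.ball x (ε / 2) ⊆ Metric.closedBall z ε := by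
      intro y hy
      rw [Metric.mem_ball] at hx hy
      rw [Metric.mem_closedBall]
      linarith [dist_triangle y x z]
    refine Complex.norm_fderiv_le_div_of_mapsTo_ball (hf.mono (hxs.trans hεU)) ?_ (by linarith)
    intro y hy
    rw [mem_closedBall_iff_norm]
    have h1 := hM y (hxs hy)
    have h2 := hM x (hxs (Metric.mem_ball_self (by linarith)))
    linarith [norm_sub_le (f y) (f x)]
  have hcirc : ∀ θ : ℝ, ‖circleMap 0 ρ θ‖ = ρ := fun θ => by
    simp [abs_of_pos hρ0]
  -- Cauchy's formula on the complex line through `w` in direction `e` expresses the derivative by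
  -- values of `f` alone, so one differentiation under the integral sign suffices.
  have hcauchy : ∀ w ∈ Metric.ball z (ε / 4), fderiv ℂ f w e = (2 * Real.pi * Complex.I)⁻¹ *
      ∫ θ in (0 : ℝ)..2 * Real.pi, deriv (circleMap 0 ρ) θ * (1 / (circleMap 0 ρ θ) ^ 2) *
        f (w + circleMap 0 ρ θ • e) := by
    intro w hw
    have hline : ∀ ζ : ℂ, HasDerivAt (fun ζ : ℂ => w + ζ • e) e ζ := fun ζ => by
      simpa using ((hasDerivAt_id ζ).smul_const e).const_add w
    have h1 : DifferentiableOn ℂ (fun ζ : ℂ => f (w + ζ • e)) (Metric.closedBall 0 ρ) := by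
      intro ζ hζ
      have h2 := hdiff _ (hsub (hmem w hw ζ (by simpa using hζ)))
      exact (h2.comp_hasDerivAt ζ (hline ζ)).differentiableAt.differentiableWithinAt
    have h3 := h1.deriv_eq_smul_circleIntegral hρ0
    have h4 : HasDerivAt (fun ζ : ℂ => f (w + ζ • e)) (fderiv ℂ f w e) 0 := by
      refine HasFDerivAt.comp_hasDerivAt (0 : ℂ) ?_ (hline 0)
      simpa using hdiff _ (hsub (hmem w hw 0 (by simpa using hρ0.le)))
    rw [h4.deriv, circleIntegral] at h3
    simp only [smul_eq_mul, sub_zero] at h3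
    rw [eq_inv_mul_iff_mul_eq₀ Complex.two_pi_I_ne_zero, ← h3]
    simp only [mul_assoc]
  have hcont : ∀ w ∈ Metric.ball z (ε / 4),
      Continuous fun θ => f (w + circleMap 0 ρ θ • e) := by
    intro w hw
    rw [← continuousOn_univ]
    refine hf.continuousOn.comp (by fun_prop) fun θ _ => hsub (hmem w hw _ (hcirc θ).le)
  have hκ : Continuous fun θ => deriv (circleMap 0 ρ) θ * (1 / (circleMap 0 ρ θ) ^ 2) := by
    have h0 : ∀ θ, circleMap 0 ρ θ ≠ 0 := fun θ => by
      rw [← norm_ne_zero_iff, hcirc]; exact hρ0.ne'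
    simp only [deriv_circleMap]
    refine Continuous.mul (by fun_prop) (Continuous.div (by fun_prop) (by fun_prop) fun θ => ?_)
    exact pow_ne_zero 2 (h0 θ)
  have hz4 : z ∈ Metric.ball z (ε / 4) := Metric.mem_ball_self (by linarith)
  have hnhds : Metric.ball z (ε / 4) ∈ nhds z := Metric.ball_mem_nhds z (by linarith)
  have hint := intervalIntegral.hasFDerivAt_integral_of_dominated_of_fderiv_le (𝕜 := ℂ)
    (μ := volume) (a := 0) (b := 2 * Real.pi) (s := Metric.ball z (ε / 4)) (x₀ := z)
    (F := fun w θ => deriv (circleMap 0 ρ) θ * (1 / (circleMap 0 ρ θ) ^ 2) *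
      f (w + circleMap 0 ρ θ • e))
    (F' := fun w θ => (deriv (circleMap 0 ρ) θ * (1 / (circleMap 0 ρ θ) ^ 2)) •
      fderiv ℂ f (w + circleMap 0 ρ θ • e))
    (bound := fun θ => ‖deriv (circleMap 0 ρ) θ * (1 / (circleMap 0 ρ θ) ^ 2)‖ *
      (2 * M / (ε / 2)))
    hnhds
    (by
      filter_upwards [hnhds] with w hw
      exact (hκ.mul (hcont w hw)).aestronglyMeasurable)
    ((hκ.mul (hcont z hz4)).intervalIntegrable _ _)
    (by
      refine (hκ.aestronglyMeasurable).smul ?_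
      have h5 : Continuous fun θ => z + circleMap 0 ρ θ • e := by fun_prop
      exact ((measurable_fderiv ℂ f).comp h5.measurable).aestronglyMeasurable)
    (by
      refine Eventually.of_forall fun θ _ w hw => ?_
      rw [norm_smul]
      gcongr
      exact hbound _ (hmem w hw _ (hcirc θ).le))
    ((hκ.norm.mul continuous_const).intervalIntegrable _ _)
    (by
      refine Eventually.of_forall fun θ _ w hw => ?_
      have h6 := hdiff _ (hsub (hmem w hw _ (hcirc θ).le))
      have h7 : HasFDerivAt (fun w => w + circleMap 0 ρ θ • e) (ContinuousLinearMap.id ℂ E) w :=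
        (hasFDerivAt_id w).add_const _
      simpa using (h6.comp w h7).const_mul _)
  refine (hint.differentiableAt.const_mul ((2 * Real.pi * Complex.I)⁻¹)).congr_of_eventuallyEq ?_
  filter_upwards [hnhds] with w hw using hcauchy w hw

/-! ### Wirtinger calculus and the Levi form of log(1 + ε ∑ |uⱼ|²). -/

section Wirtinger

variable {n : ℕ} {u w : Cn n → ℂ} {z : Cn n}

theorem single_I_eq_smul (k : Fin n) :
    (EuclideanSpace.single k Complex.I : Cn n) = Complex.I • EuclideanSpace.single k (1 : ℂ) := by
  ext i
  by_cases h : i = k <;> simp [h]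

theorem Filter.EventuallyEq.wirtinger_eq (k : Fin n) (h : u =ᶠ[nhds z] w) :
    wirtinger k u z = wirtinger k w z := by
  simp only [wirtinger, h.fderiv_eq]

theorem wirtinger_of_holomorphic (k : Fin n) (hu : DifferentiableAt ℂ u z) :
    wirtinger k u z = fderiv ℂ u z (EuclideanSpace.single k 1) := by
  rw [wirtinger, hu.fderiv_restrictScalars ℝ, single_I_eq_smul]
  simp only [ContinuousLinearMap.coe_restrictScalars', map_smul, smul_eq_mul]
  linear_combination (-(1 / 2) * fderiv ℂ u z (EuclideanSpace.single k 1)) * Complex.I_mul_I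

theorem fderiv_conj_comp (u : Cn n → ℂ) (z v : Cn n) :
    fderiv ℝ (fun x => conj (u x)) z v = conj (fderiv ℝ u z v) := by
  have h := Complex.conjCLE.comp_fderiv (f := u) (x := z)
  exact congrArg (fun L => L v) h

theorem wirtinger_conj_of_holomorphic (k : Fin n) (hu : DifferentiableAt ℂ u z) :
    wirtinger k (fun x => conj (u x)) z = 0 := by
  rw [wirtinger, fderiv_conj_comp, fderiv_conj_comp, hu.fderiv_restrictScalars ℝ,
    single_I_eq_smul]
  simp only [ContinuousLinearMap.coe_restrictScalars', map_smul, smul_eq_mul, map_mul,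
    Complex.conj_I]
  linear_combination ((1 / 2) * conj (fderiv ℂ u z (EuclideanSpace.single k 1))) * Complex.I_mul_I

theorem wirtinger_mul (k : Fin n) (hu : DifferentiableAt ℝ u z) (hw : DifferentiableAt ℝ w z) :
    wirtinger k (fun x => u x * w x) z = wirtinger k u z * w z + u z * wirtinger k w z := by
  simp only [wirtinger, fderiv_fun_mul hu hw, add_apply,
    smul_apply, smul_eq_mul]
  ring

theorem wirtinger_sum {ι : Type*} (s : Finset ι) {u : ι → Cn n → ℂ} (k : Fin n)
    (hu : ∀ j ∈ s, DifferentiableAt ℝ (u j) z) :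
    wirtinger k (fun x => ∑ j ∈ s, u j x) z = ∑ j ∈ s, wirtinger k (u j) z := by
  simp only [wirtinger, fderiv_fun_sum hu, sum_apply, Finset.mul_sum,
    ← Finset.sum_sub_distrib]

theorem wirtinger_const_mul (k : Fin n) (c : ℂ) :
    wirtinger k (fun x => c * u x) z = c * wirtinger k u z := by
  have h : fderiv ℝ (fun x => c * u x) z = c • fderiv ℝ u z :=
    congrFun (fderiv_const_smul_field (𝕜 := ℝ) (f := u) c) z
  simp only [wirtinger, h, smul_apply, smul_eq_mul]
  ring

theorem wirtinger_const_add (k : Fin n) (c : ℂ) :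
    wirtinger k (fun x => c + u x) z = wirtinger k u z := by
  simp only [wirtinger, fderiv_const_add]

theorem wirtinger_inv (k : Fin n) (hu : DifferentiableAt ℝ u z) (h0 : u z ≠ 0) :
    wirtinger k (fun x => (u x)⁻¹) z = -(wirtinger k u z / u z ^ 2) := by
  have h : HasFDerivAt (fun x => (u x)⁻¹) (-((u z) ^ 2)⁻¹ • fderiv ℝ u z) z :=
    (hasDerivAt_inv h0).comp_hasFDerivAt_of_eq z hu.hasFDerivAt rfl
  simp only [wirtinger, h.fderiv, smul_apply, smul_eq_mul]
  ring

/-- Reduces ∂/∂z̄ of real functions to ∂/∂z, so that calculus rules are needed for one operator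
only. -/
theorem wirtingerBar_ofReal (k : Fin n) (φ : Cn n → ℝ) :
    wirtingerBar k (fun x => (φ x : ℂ)) z = conj (wirtinger k (fun x => (φ x : ℂ)) z) := by
  have h : ∀ v, conj (fderiv ℝ (fun x => (φ x : ℂ)) z v) = fderiv ℝ (fun x => (φ x : ℂ)) z v := by
    intro v
    rw [← fderiv_conj_comp]
    simp only [Complex.conj_ofReal]
  simp only [wirtinger, wirtingerBar, map_mul, map_sub, h, Complex.conj_I, map_div₀, map_one,
    map_ofNat]
  ring

theorem wirtinger_log (k : Fin n) {ψ : Cn n → ℝ} (hψ : DifferentiableAt ℝ ψ z) (h0 : ψ z ≠ 0) :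
    wirtinger k (fun x => (Real.log (ψ x) : ℂ)) z
      = wirtinger k (fun x => (ψ x : ℂ)) z * (ψ z : ℂ)⁻¹ := by
  have h1 : HasFDerivAt (fun x => (ψ x : ℂ)) (Complex.ofRealCLM ∘L fderiv ℝ ψ z) z :=
    Complex.ofRealCLM.hasFDerivAt.comp z hψ.hasFDerivAt
  have h2 : HasFDerivAt (fun x => (Real.log (ψ x) : ℂ))
      (Complex.ofRealCLM ∘L ((ψ z)⁻¹ • fderiv ℝ ψ z)) z :=
    Complex.ofRealCLM.hasFDerivAt.comp z (hψ.hasFDerivAt.log h0)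
  simp only [wirtinger, h1.fderiv, h2.fderiv, ContinuousLinearMap.comp_apply,
    smul_apply, smul_eq_mul, Complex.ofRealCLM_apply, Complex.ofReal_mul,
    Complex.ofReal_inv]
  ring

theorem leviForm_const_add_mul (a b : ℝ) (φ : Cn n → ℝ) (z v : Cn n) :
    leviForm (fun x => a + b * φ x) z v = b * leviForm φ z v := by
  have h : ∀ l, wirtingerBar l (fun x => ((a + b * φ x : ℝ) : ℂ))
      = fun x => (b : ℂ) * wirtingerBar l (fun x => (φ x : ℂ)) x := by
    intro l
    ext x
    rw [wirtingerBar_ofReal, wirtingerBar_ofReal]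
    simp only [Complex.ofReal_add, Complex.ofReal_mul]
    rw [wirtinger_const_add, wirtinger_const_mul, map_mul, Complex.conj_ofReal]
  simp only [leviForm, h, wirtinger_const_mul, mul_assoc, ← Finset.mul_sum, Complex.re_ofReal_mul]

theorem leviForm_congr {φ ψ : Cn n → ℝ} (h : φ =ᶠ[nhds z] ψ) (v : Cn n) :
    leviForm φ z v = leviForm ψ z v := by
  have h1 : ∀ l, wirtingerBar l (fun x => (φ x : ℂ)) =ᶠ[nhds z]
      wirtingerBar l (fun x => (ψ x : ℂ)) := by
    intro l
    filter_upwards [h.eventuallyEq_nhds] with x hx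
    rw [wirtingerBar_ofReal, wirtingerBar_ofReal]
    exact congrArg conj (Filter.EventuallyEq.wirtinger_eq l (hx.fun_comp (fun t : ℝ => (t : ℂ))))
  simp only [leviForm, (h1 _).wirtinger_eq]

theorem sum_apply_single_mul (L : Cn n →L[ℂ] ℂ) (v : Cn n) :
    ∑ k, L (EuclideanSpace.single k 1) * v k = L v := by
  conv_rhs => rw [← (EuclideanSpace.basisFun (Fin n) ℂ).sum_repr v]
  simp [mul_comm]

/-- The algebra behind the Levi form: `p j k` stands for ∂uⱼ/∂z_k, `a j` for the derivative of uⱼ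
along `v`, and `s` for the inverse of 1 + ε ∑ |uⱼ|². Each double sum factors through the `a j`. -/
theorem sum_sum_hermitian_expand {ι κ : Type*} [Fintype ι] [Fintype κ] (p : ι → κ → ℂ)
    (u a : ι → ℂ) (v : κ → ℂ) (ha : ∀ j, ∑ k, p j k * v k = a j) (ε s : ℂ) :
    ∑ k, ∑ l, ((ε * ∑ j, conj (p j l) * p j k) * s
        + (ε * ∑ j, conj (p j l) * u j) * -((ε * ∑ j, p j k * conj (u j)) / s⁻¹ ^ 2))
        * v k * conj (v l)
      = ε * (∑ j, conj (a j) * a j) * s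
        - ε ^ 2 * ((∑ j, conj (a j) * u j) * (∑ j, a j * conj (u j))) / s⁻¹ ^ 2 := by
  have ha' : ∀ j, ∑ k, conj (p j k) * conj (v k) = conj (a j) := fun j => by
    rw [← ha j, map_sum]
    simp only [map_mul]
  have e1 : ∑ k, ∑ l, (∑ j, conj (p j l) * p j k) * v k * conj (v l) = ∑ j, conj (a j) * a j := by
    simp only [Finset.sum_mul]
    rw [Finset.sum_congr rfl fun k _ => Finset.sum_comm, Finset.sum_comm]
    refine Finset.sum_congr rfl fun j _ => ?_
    rw [mul_comm, ← ha' j, ← ha j, Finset.sum_mul_sum]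
    exact Finset.sum_congr rfl fun k _ => Finset.sum_congr rfl fun l _ => by ring
  have e2 : ∑ l, (∑ j, conj (p j l) * u j) * conj (v l) = ∑ j, conj (a j) * u j := by
    simp only [← ha', Finset.sum_mul]
    rw [Finset.sum_comm]
    exact Finset.sum_congr rfl fun j _ => Finset.sum_congr rfl fun l _ => by ring
  have e3 : ∑ k, (∑ j, p j k * conj (u j)) * v k = ∑ j, a j * conj (u j) := by
    simp only [← ha, Finset.sum_mul]
    rw [Finset.sum_comm]
    exact Finset.sum_congr rfl fun j _ => Finset.sum_congr rfl fun l _ => by ring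
  have e4 : ∀ k l, ((ε * ∑ j, conj (p j l) * p j k) * s
        + (ε * ∑ j, conj (p j l) * u j) * -((ε * ∑ j, p j k * conj (u j)) / s⁻¹ ^ 2))
        * v k * conj (v l)
      = ε * s * ((∑ j, conj (p j l) * p j k) * v k * conj (v l))
        - ε ^ 2 / s⁻¹ ^ 2 * (((∑ j, p j k * conj (u j)) * v k)
          * ((∑ j, conj (p j l) * u j) * conj (v l))) := fun k l => by ring
  simp only [e4, Finset.sum_sub_distrib, ← Finset.mul_sum, ← Finset.sum_mul, e1, e2, e3]
  ring

/-- The Levi form of `log (1 + ε ∑ⱼ |uⱼ|²)` for holomorphic functions `uⱼ`. -/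
theorem leviForm_log_one_add_mul_sum {ι : Type*} [Fintype ι] {U : Set (Cn n)} (hU : IsOpen U)
    {u : ι → Cn n → ℂ} (hu : ∀ j, DifferentiableOn ℂ (u j) U) (ε : ℝ)
    (hpos : ∀ x ∈ U, 0 < 1 + ε * ∑ j, ‖u j x‖ ^ 2) (hz : z ∈ U) (v : Cn n) :
    leviForm (fun x => Real.log (1 + ε * ∑ j, ‖u j x‖ ^ 2)) z v
      = ε * (∑ j, ‖fderiv ℂ (u j) z v‖ ^ 2) / (1 + ε * ∑ j, ‖u j z‖ ^ 2)
        - ε ^ 2 * ‖∑ j, conj (u j z) * fderiv ℂ (u j) z v‖ ^ 2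
          / (1 + ε * ∑ j, ‖u j z‖ ^ 2) ^ 2 := by
  -- The sign of ε stays free: ε = 1 with a single function gives the spherical derivative, ε = -1
  -- with the coordinates gives the Bergman metric.
  set ψ : Cn n → ℝ := fun x => 1 + ε * ∑ j, ‖u j x‖ ^ 2 with hψ
  have hψc : (fun x => (ψ x : ℂ)) = fun x => 1 + (ε : ℂ) * ∑ j, u j x * conj (u j x) := by
    ext x
    simp only [hψ, Complex.mul_conj, Complex.normSq_eq_norm_sq]
    push_cast
    rfl
  have hC : ∀ j, ∀ x ∈ U, DifferentiableAt ℂ (u j) x := fun j x hx =>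
    (hu j).differentiableAt (hU.mem_nhds hx)
  have hR : ∀ j, ∀ x ∈ U, DifferentiableAt ℝ (u j) x := fun j x hx =>
    (hC j x hx).restrictScalars ℝ
  have hRc : ∀ j, ∀ x ∈ U, DifferentiableAt ℝ (fun x => conj (u j x)) x := fun j x hx =>
    Complex.conjCLE.differentiableAt.comp x (hR j x hx)
  have hψd : ∀ x ∈ U, DifferentiableAt ℝ (fun x => (ψ x : ℂ)) x := by
    intro x hx
    rw [hψc]
    exact ((DifferentiableAt.fun_sum fun j _ => (hR j x hx).mul (hRc j x hx)).const_mul _).const_add _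
  have hψr : ∀ x ∈ U, DifferentiableAt ℝ ψ x := fun x hx =>
    (Complex.reCLM.differentiableAt.comp x (hψd x hx) :)
  have hψ0 : ∀ x ∈ U, (ψ x : ℂ) ≠ 0 := fun x hx => by exact_mod_cast (hpos x hx).ne'
  have hW : ∀ k, ∀ x ∈ U, wirtinger k (fun x => (ψ x : ℂ)) x
      = ε * ∑ j, fderiv ℂ (u j) x (EuclideanSpace.single k 1) * conj (u j x) := by
    intro k x hx
    rw [hψc, wirtinger_const_add, wirtinger_const_mul,
      wirtinger_sum _ _ fun j _ => (hR j x hx).fun_mul (hRc j x hx)]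
    congr 1
    refine Finset.sum_congr rfl fun j _ => ?_
    rw [wirtinger_mul k (hR j x hx) (hRc j x hx), wirtinger_conj_of_holomorphic k (hC j x hx),
      wirtinger_of_holomorphic k (hC j x hx), mul_zero, add_zero]
  have hB : ∀ l, wirtingerBar l (fun x => (Real.log (ψ x) : ℂ)) =ᶠ[nhds z]
      fun x => ((ε : ℂ) * ∑ j, conj (fderiv ℂ (u j) x (EuclideanSpace.single l 1)) * u j x)
        * (ψ x : ℂ)⁻¹ := by
    intro l
    filter_upwards [hU.mem_nhds hz] with x hx
    rw [wirtingerBar_ofReal, wirtinger_log l (hψr x hx) (hpos x hx).ne', hW l x hx]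
    simp only [map_mul, map_sum, map_inv₀, Complex.conj_ofReal, Complex.conj_conj]
  have hD : ∀ j l, DifferentiableAt ℂ
      (fun x => fderiv ℂ (u j) x (EuclideanSpace.single l 1)) z := fun j l =>
    differentiableAt_fderiv_apply hU (hu j) hz _
  have hDc : ∀ j l, DifferentiableAt ℝ
      (fun x => conj (fderiv ℂ (u j) x (EuclideanSpace.single l 1))) z := fun j l =>
    Complex.conjCLE.differentiableAt.comp z ((hD j l).restrictScalars ℝ)
  -- Conjugates of the holomorphic first derivatives are annihilated by ∂/∂z_k, so only the factors
  -- uⱼ and 1/ψ are differentiated.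
  have hWB : ∀ k l, wirtinger k (wirtingerBar l (fun x => (Real.log (ψ x) : ℂ))) z
      = (ε * ∑ j, conj (fderiv ℂ (u j) z (EuclideanSpace.single l 1))
          * fderiv ℂ (u j) z (EuclideanSpace.single k 1)) * (ψ z : ℂ)⁻¹
        + (ε * ∑ j, conj (fderiv ℂ (u j) z (EuclideanSpace.single l 1)) * u j z)
          * -((ε * ∑ j, fderiv ℂ (u j) z (EuclideanSpace.single k 1) * conj (u j z))
            / (ψ z : ℂ) ^ 2) := by
    intro k l
    have h1 : ∀ j, DifferentiableAt ℝ
        (fun x => conj (fderiv ℂ (u j) x (EuclideanSpace.single l 1)) * u j x) z := fun j =>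
      (hDc j l).mul (hR j z hz)
    rw [(hB l).wirtinger_eq k, wirtinger_mul k
      ((DifferentiableAt.fun_sum fun j _ => h1 j).const_mul _)
      ((hψd z hz).fun_inv (hψ0 z hz)), wirtinger_inv k (hψd z hz) (hψ0 z hz), hW k z hz,
      wirtinger_const_mul, wirtinger_sum _ _ fun j _ => h1 j]
    congr 3
    refine Finset.sum_congr rfl fun j _ => ?_
    rw [wirtinger_mul k (hDc j l) (hR j z hz), wirtinger_conj_of_holomorphic k (hD j l),
      wirtinger_of_holomorphic k (hC j z hz), zero_mul, zero_add]
  have hsum : ∀ j, ∑ k, fderiv ℂ (u j) z (EuclideanSpace.single k 1) * v k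
      = fderiv ℂ (u j) z v := fun j => sum_apply_single_mul _ v
  set a : ι → ℂ := fun j => fderiv ℂ (u j) z v with ha
  have hcalc : ∑ k, ∑ l, wirtinger k (wirtingerBar l (fun x => (Real.log (ψ x) : ℂ))) z
        * v k * conj (v l)
      = ε * (∑ j, conj (a j) * a j) * (ψ z : ℂ)⁻¹
        - ε ^ 2 * ((∑ j, conj (a j) * u j z) * (∑ j, a j * conj (u j z))) / (ψ z : ℂ) ^ 2 := by
    have h := sum_sum_hermitian_expand
      (fun j k => fderiv ℂ (u j) z (EuclideanSpace.single k 1)) (fun j => u j z) a v hsum ε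
      (ψ z : ℂ)⁻¹
    rw [inv_inv] at h
    simp only [hWB]
    exact h
  rw [leviForm, hcalc]
  have q1 : (∑ j, conj (a j) * a j : ℂ) = ((∑ j, ‖a j‖ ^ 2 : ℝ) : ℂ) := by
    push_cast
    exact Finset.sum_congr rfl fun j _ => Complex.conj_mul' _
  have q2 : (∑ j, conj (a j) * u j z) * (∑ j, a j * conj (u j z))
      = ((‖∑ j, conj (u j z) * a j‖ ^ 2 : ℝ) : ℂ) := by
    push_cast
    rw [← Complex.conj_mul', map_sum]
    congr 1
    · exact Finset.sum_congr rfl fun j _ => by simp [mul_comm]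
    · exact Finset.sum_congr rfl fun j _ => mul_comm _ _
  rw [q1, q2, ← Complex.ofReal_inv, ← Complex.ofReal_pow, ← Complex.ofReal_mul,
    ← Complex.ofReal_mul, ← Complex.ofReal_pow, ← Complex.ofReal_mul, ← Complex.ofReal_div,
    ← Complex.ofReal_sub, Complex.ofReal_re, ← div_eq_mul_inv]

end Wirtinger

/-! ### Möbius maps of the ball. -/

section Mobius

variable {n : ℕ} {w z : Cn n}

theorem mem_unitBall : z ∈ unitBall n ↔ ‖z‖ < 1 := mem_ball_zero_iff

/-- The number `√(1 - ‖w‖²)`. -/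
noncomputable def ballScale (w : Cn n) : ℝ := √(1 - ‖w‖ ^ 2)

theorem ballScale_pos (hw : ‖w‖ < 1) : 0 < ballScale w :=
  Real.sqrt_pos.2 (by nlinarith [norm_nonneg w])

theorem ballScale_sq (hw : ‖w‖ < 1) : ballScale w ^ 2 = 1 - ‖w‖ ^ 2 :=
  Real.sq_sqrt (by nlinarith [norm_nonneg w])

theorem inner_self_eq_one_sub_ballScale_sq (hw : ‖w‖ < 1) :
    inner ℂ w w = 1 - (ballScale w : ℂ) ^ 2 := by
  have h : ‖w‖ ^ 2 = 1 - ballScale w ^ 2 := by linarith [ballScale_sq hw]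
  rw [inner_self_eq_norm_sq_to_K]
  refine (Complex.ofReal_pow ‖w‖ 2).symm.trans ?_
  rw [h]
  push_cast
  rfl

theorem ballScale_neg : ballScale (-w) = ballScale w := by simp [ballScale]

/-- The linear map `P + √(1 - ‖w‖²) Q`, where `P` is the orthogonal projection to `ℂ w` and
`Q = 1 - P`. -/
noncomputable def ballShear (w : Cn n) : Cn n →L[ℂ] Cn n :=
  (ballScale w : ℂ) • ContinuousLinearMap.id ℂ (Cn n)
    + ((1 + ballScale w : ℝ) : ℂ)⁻¹ • (innerSL ℂ w).smulRight w

/-- With s = `ballScale w`, the coefficient 1/(1+s) equals (1-s)/‖w‖² when w ≠ 0; in this form w = 0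
is no special case. -/
theorem ballShear_apply (w z : Cn n) : ballShear w z
    = (ballScale w : ℂ) • z + (((1 + ballScale w : ℝ) : ℂ)⁻¹ * inner ℂ w z) • w := by
  simp [ballShear, mul_smul]

theorem inner_ballShear (hw : ‖w‖ < 1) (z : Cn n) : inner ℂ w (ballShear w z) = inner ℂ w z := by
  have hs := ballScale_pos hw
  have h3 : ((1 + ballScale w : ℝ) : ℂ) ≠ 0 := by exact_mod_cast (by linarith : 1 + ballScale w ≠ 0)
  rw [ballShear_apply, inner_add_right, inner_smul_right, inner_smul_right,
    inner_self_eq_one_sub_ballScale_sq hw]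
  field_simp
  push_cast
  ring

/-- Pythagoras: ‖Pz‖² + s²‖Qz‖² = s²‖z‖² + (1 - s²)‖Pz‖², where 1 - s² = ‖w‖². -/
theorem norm_ballShear_sq (hw : ‖w‖ < 1) (z : Cn n) :
    ‖ballShear w z‖ ^ 2 = ballScale w ^ 2 * ‖z‖ ^ 2 + ‖inner ℂ w z‖ ^ 2 := by
  have hs := ballScale_pos hw
  have h3 : inner ℂ ((ballScale w : ℂ) • z) ((((1 + ballScale w : ℝ) : ℂ)⁻¹ * inner ℂ w z) • w)
      = ((ballScale w * (1 + ballScale w)⁻¹ * ‖inner ℂ w z‖ ^ 2 : ℝ) : ℂ) := by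
    rw [inner_smul_left, inner_smul_right, ← inner_conj_symm z w]
    push_cast
    rw [← Complex.mul_conj', Complex.conj_ofReal]
    ring
  rw [ballShear_apply, norm_add_sq (𝕜 := ℂ), h3, norm_smul, norm_smul, norm_mul, norm_inv,
    Complex.norm_real, Complex.norm_real, Real.norm_of_nonneg hs.le,
    Real.norm_of_nonneg (by linarith : (0 : ℝ) ≤ 1 + ballScale w), mul_pow, mul_pow _ ‖w‖,
    (by linarith [ballScale_sq hw] : ‖w‖ ^ 2 = 1 - ballScale w ^ 2)]
  simp only [RCLike.re_eq_complex_re, Complex.ofReal_re]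
  field_simp
  ring

/-- The automorphism of the unit ball that maps `0` to `w`. -/
noncomputable def ballMobius (w z : Cn n) : Cn n := (1 + inner ℂ w z)⁻¹ • (w + ballShear w z)

theorem one_add_inner_ne_zero (hw : ‖w‖ < 1) (hz : ‖z‖ < 1) : 1 + inner ℂ w z ≠ 0 := by
  intro h
  have h1 := norm_inner_le_norm (𝕜 := ℂ) w z
  rw [eq_neg_of_add_eq_zero_right h, norm_neg, norm_one] at h1
  nlinarith [norm_nonneg w, norm_nonneg z]

theorem ballMobius_zero (w : Cn n) : ballMobius w 0 = w := by simp [ballMobius]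

theorem ballMobius_neg_self (hw : ‖w‖ < 1) : ballMobius (-w) w = 0 := by
  have hs := ballScale_pos hw
  have h3 : (1 + ballScale w : ℂ) ≠ 0 := by
    exact_mod_cast (by linarith : 1 + ballScale w ≠ 0)
  have : -w + ballShear (-w) w = 0 := by
    rw [ballShear_apply, inner_neg_left, ballScale_neg, inner_self_eq_one_sub_ballScale_sq hw]
    push_cast
    match_scalars
    field_simp
    ring
  rw [ballMobius, this, smul_zero]

theorem norm_ballMobius_lt_one (hw : ‖w‖ < 1) (hz : ‖z‖ < 1) : ‖ballMobius w z‖ < 1 := by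
  have hd := one_add_inner_ne_zero hw hz
  -- After division by |1 + ⟨w,z⟩|² this is the classical formula for 1 - ‖φ(z)‖².
  have h1 : ‖w + ballShear w z‖ ^ 2 = ‖1 + inner ℂ w z‖ ^ 2 - ballScale w ^ 2 * (1 - ‖z‖ ^ 2) := by
    rw [norm_add_sq (𝕜 := ℂ), inner_ballShear hw, norm_ballShear_sq hw, norm_add_sq_real,
      norm_one, ballScale_sq hw, Complex.inner]
    simp
    ring
  have h2 : ‖w + ballShear w z‖ < ‖1 + inner ℂ w z‖ := by
    refine lt_of_pow_lt_pow_left₀ 2 (norm_nonneg _) ?_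
    have : 0 < 1 - ‖z‖ ^ 2 := by nlinarith [norm_nonneg z]
    have := mul_pos (pow_pos (ballScale_pos hw) 2) this
    linarith
  rw [ballMobius, norm_smul, norm_inv, inv_mul_lt_one₀ (norm_pos_iff.2 hd)]
  exact h2

theorem ballMobius_injOn (hw : ‖w‖ < 1) : InjOn (ballMobius w) (unitBall n) := by
  intro z hz z' hz' h
  rw [mem_unitBall] at hz hz'
  have hd := one_add_inner_ne_zero hw hz
  have hd' := one_add_inner_ne_zero hw hz'
  have hs := ballScale_pos hw
  have hs' : (ballScale w : ℂ) ≠ 0 := by exact_mod_cast hs.ne'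
  have h1 := congrArg (inner ℂ w) h
  simp only [ballMobius, inner_smul_right, inner_add_right, inner_ballShear hw,
    inner_self_eq_one_sub_ballScale_sq hw] at h1
  -- Pairing with `w` yields t ↦ (1 - s² + t)/(1 + t) at t = ⟨w,z⟩, a fractional linear map of
  -- determinant s² ≠ 0, hence injective.
  have hx : inner ℂ w z = inner ℂ w z' := by
    rw [inv_mul_eq_div, inv_mul_eq_div, div_eq_div_iff hd hd'] at h1
    refine mul_left_cancel₀ (pow_ne_zero 2 hs') ?_
    linear_combination h1
  simp only [ballMobius, hx] at h
  have h3 := add_left_cancel (smul_right_injective _ (inv_ne_zero hd') h)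
  rw [ballShear_apply, ballShear_apply, hx] at h3
  exact smul_right_injective _ hs' (add_right_cancel h3)

theorem hasFDerivAt_ballMobius (hd : 1 + inner ℂ w z ≠ 0) :
    HasFDerivAt (ballMobius w) ((1 + inner ℂ w z)⁻¹ • ballShear w
      + (innerSL ℂ w).smulRight (-((1 + inner ℂ w z) ^ 2)⁻¹ • (w + ballShear w z))) z := by
  have h1 : HasFDerivAt (fun z : Cn n => 1 + inner ℂ w z) (innerSL ℂ w) z :=
    (innerSL ℂ w).hasFDerivAt.const_add 1
  have h2 : HasFDerivAt (fun z : Cn n => (1 + inner ℂ w z)⁻¹)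
      (-((1 + inner ℂ w z) ^ 2)⁻¹ • innerSL ℂ w) z :=
    (hasDerivAt_inv hd).comp_hasFDerivAt_of_eq z h1 rfl
  have h3 := h2.fun_smul ((ballShear w).hasFDerivAt.const_add w)
  convert! h3 using 2
  ext1 v
  simp [smul_smul, mul_comm]

theorem differentiableOn_ballMobius (hw : ‖w‖ < 1) :
    DifferentiableOn ℂ (ballMobius w) (unitBall n) := fun _ hz =>
  (hasFDerivAt_ballMobius
    (one_add_inner_ne_zero hw (mem_unitBall.1 hz))).differentiableAt.differentiableWithinAt

/-- The derivative is the scalar s/d, with d = 1 + ⟨w,z⟩, times a rank-one perturbation of the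
identity. The scalar contributes (s/d)^n and the perturbation one more factor s/d. -/
theorem det_fderiv_ballMobius (hw : ‖w‖ < 1) (hd : 1 + inner ℂ w z ≠ 0) :
    (fderiv ℂ (ballMobius w) z).det = ((ballScale w : ℂ) / (1 + inner ℂ w z)) ^ (n + 1) := by
  have hs := ballScale_pos hw
  have hs' : (ballScale w : ℂ) ≠ 0 := by exact_mod_cast hs.ne'
  have h3 : (1 + ballScale w : ℂ) ≠ 0 := by
    exact_mod_cast (by linarith : 1 + ballScale w ≠ 0)
  have hIS : inner ℂ w (ballShear w z) = inner ℂ w z := inner_ballShear hw z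
  set d : ℂ := 1 + inner ℂ w z with hdef
  set b : Cn n := (d / ballScale w) • ((d * (1 + ballScale w))⁻¹ • w
    - (d ^ 2)⁻¹ • (w + ballShear w z)) with hb
  have hfd : ((fderiv ℂ (ballMobius w) z : Cn n →L[ℂ] Cn n) : Cn n →ₗ[ℂ] Cn n)
      = ((ballScale w : ℂ) / d) • LinearMap.transvection (innerSL ℂ w : Cn n →ₗ[ℂ] ℂ) b := by
    ext1 v
    rw [(hasFDerivAt_ballMobius hd).fderiv]
    simp only [LinearMap.smul_apply, LinearMap.transvection.apply, ContinuousLinearMap.coe_coe,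
      add_apply, smul_apply, ContinuousLinearMap.smulRight_apply,
      innerSL_apply_apply, ballShear_apply w v, hb, ← hdef]
    push_cast
    match_scalars <;> field_simp
    ring
  rw [ContinuousLinearMap.det, hfd, LinearMap.det_smul, LinearMap.transvection.det,
    finrank_euclideanSpace_fin, pow_succ]
  congr 1
  simp only [ContinuousLinearMap.coe_coe, innerSL_apply_apply, hb, inner_smul_right,
    inner_sub_right, inner_add_right, inner_self_eq_one_sub_ballScale_sq hw, hIS]
  rw [(by rw [hdef]; ring : inner ℂ w z = d - 1)]
  field_simp
  ring

/-- The numerator of the Möbius map vanishes at `w`, so the quotient rule leaves only the shear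
divided by s². Up to the factor n+1 the right side will be the Bergman metric. -/
theorem norm_fderiv_ballMobius_neg_self_sq (hw : ‖w‖ < 1) (v : Cn n) :
    ‖fderiv ℂ (ballMobius (-w)) w v‖ ^ 2
      = ‖v‖ ^ 2 / (1 - ‖w‖ ^ 2) + ‖inner ℂ w v‖ ^ 2 / (1 - ‖w‖ ^ 2) ^ 2 := by
  have hs := ballScale_pos hw
  have hw' : ‖-w‖ < 1 := by rwa [norm_neg]
  have hd := one_add_inner_ne_zero hw' hw
  have h0 : -w + ballShear (-w) w = 0 := by
    have := ballMobius_neg_self hw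
    rw [ballMobius, smul_eq_zero] at this
    exact this.resolve_left (inv_ne_zero hd)
  have hd2 : 1 + inner ℂ (-w) w = ((ballScale w ^ 2 : ℝ) : ℂ) := by
    rw [inner_neg_left, inner_self_eq_norm_sq_to_K, ballScale_sq hw]
    push_cast
    rfl
  rw [(hasFDerivAt_ballMobius hd).fderiv, h0, hd2]
  simp only [smul_zero, add_apply, smul_apply,
    ContinuousLinearMap.smulRight_apply, add_zero]
  rw [norm_smul, mul_pow, norm_ballShear_sq hw', ballScale_neg, norm_inv, Complex.norm_real,
    Real.norm_of_nonneg (sq_nonneg _), inner_neg_left, norm_neg, ← ballScale_sq hw]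
  field_simp

end Mobius

/-! ### Evaluation bounds on the Bergman space and their transport by Möbius maps. -/

section BergmanSpace

variable {n : ℕ} {w z : Cn n}

theorem isOpen_unitBall : IsOpen (unitBall n) := Metric.isOpen_ball

theorem volume_unitBall_ne_top : volume (unitBall n) ≠ ∞ :=
  (Metric.isBounded_ball.measure_lt_top).ne

theorem volume_unitBall_ne_zero : volume (unitBall n) ≠ 0 :=
  (Metric.measure_ball_pos volume 0 one_pos).ne'

/-- Change of variables for injective holomorphic maps. -/
theorem lintegral_enorm_det_fderiv_sq_mul_le {Ω : Set (Cn n)} (hΩ : IsOpen Ω) {A : Cn n → Cn n}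
    (hA : DifferentiableOn ℂ A Ω) (hinj : InjOn A Ω) (hmaps : MapsTo A Ω Ω) (g : Cn n → ℝ≥0∞) :
    ∫⁻ x in Ω, ‖(fderiv ℂ A x).det‖ₑ ^ 2 * g (A x) ≤ ∫⁻ x in Ω, g x := by
  -- The real Jacobian of a complex linear map is the squared modulus of its complex determinant.
  have hdet : ∀ x, |((fderiv ℂ A x).restrictScalars ℝ).det| = ‖(fderiv ℂ A x).det‖ ^ 2 := by
    intro x
    have h : ((fderiv ℂ A x).restrictScalars ℝ).det = Algebra.norm ℝ (fderiv ℂ A x).det :=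
      LinearMap.det_restrictScalars
    rw [h, Algebra.norm_complex_apply, Complex.normSq_eq_norm_sq, abs_of_nonneg (sq_nonneg _)]
  have h := lintegral_image_eq_lintegral_abs_det_fderiv_mul volume hΩ.measurableSet
    (f := A) (f' := fun x => (fderiv ℂ A x).restrictScalars ℝ)
    (fun x hx => ((hA.differentiableAt (hΩ.mem_nhds hx)).hasFDerivAt.restrictScalars
      ℝ).hasFDerivWithinAt) hinj g
  calc ∫⁻ x in Ω, ‖(fderiv ℂ A x).det‖ₑ ^ 2 * g (A x) = ∫⁻ x in A '' Ω, g x := by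
        rw [h]
        refine lintegral_congr fun x => ?_
        rw [hdet, ENNReal.ofReal_pow (norm_nonneg _), ofReal_norm]
    _ ≤ ∫⁻ x in Ω, g x := lintegral_mono_set hmaps.image_subset

theorem lintegral_unitBall_smul_le {c : ℂ} (hc : ‖c‖ = 1) (g : Cn n → ℝ≥0∞) :
    ∫⁻ x in unitBall n, g (c • x) ≤ ∫⁻ x in unitBall n, g x := by
  have hd : ∀ x : Cn n, HasFDerivAt (fun x : Cn n => c • x)
      (c • ContinuousLinearMap.id ℂ (Cn n)) x := fun x => (hasFDerivAt_id x).const_smul c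
  have hdet : ∀ x : Cn n, ‖(fderiv ℂ (fun x : Cn n => c • x) x).det‖ₑ ^ 2 = 1 := by
    intro x
    have h : ((c • ContinuousLinearMap.id ℂ (Cn n) : Cn n →L[ℂ] Cn n) : Cn n →ₗ[ℂ] Cn n)
      = c • LinearMap.id := rfl
    rw [(hd x).fderiv, ContinuousLinearMap.det, h, LinearMap.det_smul, LinearMap.det_id, mul_one,
      ← ofReal_norm, norm_pow, hc]
    simp
  have hc0 : c ≠ 0 := norm_ne_zero_iff.1 (hc.symm ▸ one_ne_zero)
  have h := lintegral_enorm_det_fderiv_sq_mul_le (isOpen_unitBall (n := n))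
    (A := fun x => c • x) (fun x _ => (hd x).differentiableAt.differentiableWithinAt)
    (smul_right_injective _ hc0).injOn
    (fun x hx => by rw [mem_unitBall] at hx ⊢; rwa [norm_smul, hc, one_mul]) g
  simpa only [hdet, one_mul] using h

/-- The mean value property of ζ ↦ f(ζx)² on the unit circle, integrated over x. Tonelli and
rotation invariance of the ball replace polar coordinates. -/
theorem enorm_zero_sq_mul_volume_le {f : Cn n → ℂ} (hf : DifferentiableOn ℂ f (unitBall n)) :
    ‖f 0‖ₑ ^ 2 * volume (unitBall n) ≤ ∫⁻ x in unitBall n, ‖f x‖ₑ ^ 2 := by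
  classical
  -- Extension by zero supplies the joint measurability required by Tonelli, since `f` is arbitrary
  -- off the ball.
  set F : Cn n → ℂ := (unitBall n).indicator f with hF
  have hFm : Measurable F := by
    rw [hF, ← piecewise_eq_indicator]
    exact (hf.continuousOn).measurable_piecewise continuousOn_const isOpen_unitBall.measurableSet
  have hFeq : ∫⁻ x in unitBall n, ‖F x‖ₑ ^ 2 = ∫⁻ x in unitBall n, ‖f x‖ₑ ^ 2 := by
    refine setLIntegral_congr_fun isOpen_unitBall.measurableSet fun x hx => ?_
    simp only [hF, indicator_of_mem hx]
  set I : Set ℝ := Ioc 0 (2 * Real.pi)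
  have hI : volume I = ENNReal.ofReal (2 * Real.pi) := by simp [I]
  have hI0 : volume I ≠ 0 := by
    rw [hI]
    exact (ENNReal.ofReal_pos.2 Real.two_pi_pos).ne'
  have hI1 : volume I ≠ ∞ := by
    rw [hI]
    exact ENNReal.ofReal_ne_top
  have hmean : ∀ x ∈ unitBall n,
      ‖f 0‖ₑ ^ 2 * volume I ≤ ∫⁻ θ in I, ‖F (circleMap 0 1 θ • x)‖ₑ ^ 2 := by
    intro x hx
    rw [mem_unitBall] at hx
    have hmem : ∀ ζ : ℂ, ‖ζ‖ ≤ 1 → ζ • x ∈ unitBall n := by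
      intro ζ hζ
      rw [mem_unitBall, norm_smul]
      nlinarith [norm_nonneg x, norm_nonneg ζ]
    have hd : DifferentiableOn ℂ (fun ζ : ℂ => f (ζ • x) ^ 2) (Metric.closedBall 0 1) := by
      refine (hf.comp (t := unitBall n) ?_ fun ζ hζ => hmem ζ (by simpa using hζ)).pow 2
      exact (differentiable_id.smul_const x).differentiableOn
    have h1 : Real.circleAverage (fun ζ : ℂ => f (ζ • x) ^ 2) 0 1 = f ((0 : ℂ) • x) ^ 2 := by
      refine DiffContOnCl.circleAverage ?_
      rw [abs_one]
      exact (hd.mono Metric.closure_ball_subset_closedBall).diffContOnCl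
    rw [zero_smul, Real.circleAverage_def] at h1
    have h2 : ‖f 0‖ₑ ^ 2 * volume I
        = ‖∫ θ in I, f (circleMap 0 1 θ • x) ^ 2‖ₑ := by
      rw [← intervalIntegral.integral_of_le Real.two_pi_pos.le, ← enorm_pow, ← h1, enorm_smul, hI,
        Real.enorm_eq_ofReal (by positivity), mul_right_comm, ← ENNReal.ofReal_mul (by positivity),
        inv_mul_cancel₀ Real.two_pi_pos.ne', ENNReal.ofReal_one, one_mul]
    rw [h2]
    refine (enorm_integral_le_lintegral_enorm _).trans_eq (lintegral_congr fun θ => ?_)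
    rw [enorm_pow, hF, indicator_of_mem (hmem _ (by simp))]
  have hmeas : AEMeasurable (Function.uncurry fun (x : Cn n) (θ : ℝ) =>
      ‖F (circleMap 0 1 θ • x)‖ₑ ^ 2)
      ((volume.restrict (unitBall n)).prod (volume.restrict I)) := by
    have hc : Continuous fun p : Cn n × ℝ => circleMap 0 1 p.2 • p.1 := by fun_prop
    exact ((hFm.comp hc.measurable).enorm.pow_const 2).aemeasurable
  have key : ‖f 0‖ₑ ^ 2 * volume (unitBall n) * volume I
      ≤ (∫⁻ x in unitBall n, ‖f x‖ₑ ^ 2) * volume I := by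
    calc ‖f 0‖ₑ ^ 2 * volume (unitBall n) * volume I
        = ∫⁻ _ in unitBall n, ‖f 0‖ₑ ^ 2 * volume I := by
          rw [setLIntegral_const, mul_right_comm]
      _ ≤ ∫⁻ x in unitBall n, ∫⁻ θ in I, ‖F (circleMap 0 1 θ • x)‖ₑ ^ 2 :=
          setLIntegral_mono' isOpen_unitBall.measurableSet hmean
      _ = ∫⁻ θ in I, ∫⁻ x in unitBall n, ‖F (circleMap 0 1 θ • x)‖ₑ ^ 2 :=
          lintegral_lintegral_swap hmeas
      _ ≤ ∫⁻ _ in I, ∫⁻ x in unitBall n, ‖F x‖ₑ ^ 2 :=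
          lintegral_mono fun θ => lintegral_unitBall_smul_le (by simp) fun x => ‖F x‖ₑ ^ 2
      _ = (∫⁻ x in unitBall n, ‖f x‖ₑ ^ 2) * volume I := by rw [setLIntegral_const, hFeq]
  exact (ENNReal.mul_le_mul_iff_left hI0 hI1).1 key

theorem mem_bergmanSpace_iff {Ω : Set (Cn n)} (hΩ : IsOpen Ω) {f : Cn n → ℂ} :
    f ∈ bergmanSpace Ω ↔ DifferentiableOn ℂ f Ω ∧ ∫⁻ x in Ω, ‖f x‖ₑ ^ 2 < ∞ := by
  have h2 := eLpNorm_nnreal_pow_eq_lintegral (f := f) (μ := volume.restrict Ω)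
    (p := 2) two_ne_zero
  norm_num at h2
  rw [← h2]
  refine and_congr_right fun hf => ?_
  have hm : AEStronglyMeasurable f (volume.restrict Ω) :=
    hf.continuousOn.aestronglyMeasurable hΩ.measurableSet
  simp only [MemLp, hm, true_and, ENNReal.pow_lt_top_iff]
  simp

theorem norm_bergmanToLp_sq {Ω : Set (Cn n)} (f : bergmanSpace Ω) :
    ‖bergmanToLp Ω f‖ ^ 2 = (∫⁻ x in Ω, ‖f.1 x‖ₑ ^ 2).toReal := by
  have h2 := eLpNorm_nnreal_pow_eq_lintegral (f := f.1) (μ := volume.restrict Ω)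
    (p := 2) two_ne_zero
  norm_num at h2
  rw [← h2, ENNReal.toReal_pow]
  exact congrArg (· ^ 2) (Lp.norm_toLp f.1 f.2.2)

/-- The weighted composition with the automorphism `ballMobius w`. -/
noncomputable def ballPullback (w : Cn n) (f : Cn n → ℂ) (z : Cn n) : ℂ :=
  ((ballScale w : ℂ) / (1 + inner ℂ w z)) ^ (n + 1) * f (ballMobius w z)

theorem lintegral_ballPullback_le (hw : ‖w‖ < 1) (f : Cn n → ℂ) :
    ∫⁻ x in unitBall n, ‖ballPullback w f x‖ₑ ^ 2 ≤ ∫⁻ x in unitBall n, ‖f x‖ₑ ^ 2 := by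
  refine le_of_eq_of_le ?_ (lintegral_enorm_det_fderiv_sq_mul_le isOpen_unitBall
    (differentiableOn_ballMobius hw) (ballMobius_injOn hw) (fun z hz => mem_unitBall.2
      (norm_ballMobius_lt_one hw (mem_unitBall.1 hz))) fun x => ‖f x‖ₑ ^ 2)
  refine setLIntegral_congr_fun isOpen_unitBall.measurableSet fun x hx => ?_
  rw [det_fderiv_ballMobius hw (one_add_inner_ne_zero hw (mem_unitBall.1 hx)), ← mul_pow,
    ← enorm_mul, ballPullback]

theorem ballPullback_mem (hw : ‖w‖ < 1) {f : Cn n → ℂ} (hf : f ∈ bergmanSpace (unitBall n)) :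
    ballPullback w f ∈ bergmanSpace (unitBall n) := by
  rw [mem_bergmanSpace_iff isOpen_unitBall] at hf ⊢
  refine ⟨?_, (lintegral_ballPullback_le hw f).trans_lt hf.2⟩
  have h1 : DifferentiableOn ℂ (fun z : Cn n => 1 + inner ℂ w z) (unitBall n) :=
    ((innerSL ℂ w).differentiable.const_add 1).differentiableOn
  have h2 : DifferentiableOn ℂ (fun z : Cn n => (ballScale w : ℂ) / (1 + inner ℂ w z))
      (unitBall n) := by
    simp only [div_eq_mul_inv]
    exact (h1.fun_inv fun z hz => one_add_inner_ne_zero hw (mem_unitBall.1 hz)).const_mul _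
  exact (h2.fun_pow _).fun_mul (hf.1.comp (differentiableOn_ballMobius hw) fun z hz =>
    mem_unitBall.2 (norm_ballMobius_lt_one hw (mem_unitBall.1 hz)))

/-- `M` bounds the squared norm of the evaluation at `z` on the Bergman space of the ball. -/
def EvalBound (z : Cn n) (M : ℝ) : Prop :=
  ∀ f : bergmanSpace (unitBall n), ‖f.1 z‖ ^ 2 ≤ M * ‖bergmanToLp (unitBall n) f‖ ^ 2

theorem evalBound_zero : EvalBound (0 : Cn n) (volume (unitBall n)).toReal⁻¹ := by
  intro f
  have hf := (mem_bergmanSpace_iff isOpen_unitBall).1 f.2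
  rw [norm_bergmanToLp_sq, ← div_eq_inv_mul,
    le_div_iff₀ (ENNReal.toReal_pos volume_unitBall_ne_zero volume_unitBall_ne_top)]
  have h := ENNReal.toReal_mono hf.2.ne (enorm_zero_sq_mul_volume_le hf.1)
  simpa using h

/-- The bound at `x` is applied to the pullback of `f`: its value at `x` is a Jacobian factor times
`f y`, and its norm is at most that of `f`. -/
theorem EvalBound.of_ballPullback {x y : Cn n} {M c : ℝ} (hw : ‖w‖ < 1) (hM : EvalBound x M)
    (hM0 : 0 ≤ M) (hxy : ballMobius w x = y) (hc : 0 < c)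
    (hJ : ‖((ballScale w : ℂ) / (1 + inner ℂ w x)) ^ (n + 1)‖ ^ 2 = c) : EvalBound y (M / c) := by
  intro f
  have hU := ballPullback_mem hw f.2
  have hf := (mem_bergmanSpace_iff isOpen_unitBall).1 f.2
  have h1 := hM ⟨_, hU⟩
  have h2 : ‖bergmanToLp (unitBall n) ⟨_, hU⟩‖ ^ 2 ≤ ‖bergmanToLp (unitBall n) f‖ ^ 2 := by
    rw [norm_bergmanToLp_sq, norm_bergmanToLp_sq]
    exact ENNReal.toReal_mono hf.2.ne (lintegral_ballPullback_le hw f.1)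
  simp only [ballPullback, norm_mul, mul_pow, hJ, hxy] at h1
  rw [div_mul_eq_mul_div, le_div_iff₀ hc, mul_comm]
  exact h1.trans (mul_le_mul_of_nonneg_left h2 hM0)

theorem EvalBound.of_zero {M : ℝ} (hM : EvalBound (0 : Cn n) M) (hM0 : 0 ≤ M) (hw : ‖w‖ < 1) :
    EvalBound w (M / (1 - ‖w‖ ^ 2) ^ (n + 1)) := by
  have hs := ballScale_pos hw
  refine hM.of_ballPullback hw hM0 (ballMobius_zero w) ?_ ?_
  · rw [← ballScale_sq hw]
    positivity
  · rw [inner_zero_right, add_zero, div_one, norm_pow, Complex.norm_real,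
      Real.norm_of_nonneg hs.le, ← ballScale_sq hw, pow_right_comm]

theorem EvalBound.to_zero {M : ℝ} (hM : EvalBound w M) (hM0 : 0 ≤ M) (hw : ‖w‖ < 1) :
    EvalBound (0 : Cn n) (M * (1 - ‖w‖ ^ 2) ^ (n + 1)) := by
  have hs := ballScale_pos hw
  have hw' : ‖-w‖ < 1 := by rwa [norm_neg]
  rw [← div_inv_eq_mul]
  refine hM.of_ballPullback hw' hM0 (ballMobius_neg_self hw) ?_ ?_
  · rw [← ballScale_sq hw]
    positivity
  -- Here the Jacobian base is s/(1 - ‖w‖²) = 1/s, inverse to the one in `EvalBound.of_zero`.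
  · rw [inner_neg_left, inner_self_eq_one_sub_ballScale_sq hw, ballScale_neg, neg_sub,
      add_sub_cancel, norm_pow, norm_div, norm_pow, Complex.norm_real,
      Real.norm_of_nonneg hs.le, ← ballScale_sq hw, pow_right_comm, ← inv_pow]
    congr 1
    field_simp

end BergmanSpace

/-! ### The Bergman kernel on the diagonal and the Bergman metric of the ball. -/

section BergmanKernel

variable {n : ℕ} {w z : Cn n} {S : Set (Cn n → ℂ)}

namespace IsCompleteOrthonormalSystem

theorem orthonormal {Ω : Set (Cn n)} (hS : IsCompleteOrthonormalSystem Ω S) :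
    Orthonormal ℂ fun φ : S => bergmanToLp Ω ⟨φ.1, hS.subset φ.2⟩ := by
  refine ⟨fun φ => ?_, fun φ ψ h => ?_⟩
  · have h := inner_self_eq_norm_sq_to_K (𝕜 := ℂ) (bergmanToLp Ω ⟨φ.1, hS.subset φ.2⟩)
    rw [inner_bergmanToLp, hS.unit _ φ.2] at h
    have h2 : ‖bergmanToLp Ω ⟨φ.1, hS.subset φ.2⟩‖ ^ 2 = 1 :=
      Complex.ofReal_injective ((Complex.ofReal_pow _ 2).trans (h.symm.trans Complex.ofReal_one.symm))
    exact (pow_eq_one_iff_of_nonneg (norm_nonneg _) two_ne_zero).1 h2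
  · refine (inner_bergmanToLp Ω _ _).trans ?_
    exact hS.orthogonal _ ψ.2 _ φ.2 fun h' => h (Subtype.ext h'.symm)

theorem norm_sum_smul_sq {Ω : Set (Cn n)} (hS : IsCompleteOrthonormalSystem Ω S) (T : Finset S)
    (c : S → ℂ) : ‖bergmanToLp Ω (∑ φ ∈ T, c φ • ⟨φ.1, hS.subset φ.2⟩)‖ ^ 2
      = ∑ φ ∈ T, ‖c φ‖ ^ 2 := by
  have h := hS.orthonormal.inner_sum c c T
  rw [inner_self_eq_norm_sq_to_K] at h
  simp only [map_sum, map_smul]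
  refine Complex.ofReal_injective ((Complex.ofReal_pow _ 2).trans (h.trans ?_))
  rw [Complex.ofReal_sum]
  exact Finset.sum_congr rfl fun φ _ => (Complex.conj_mul' _).trans (Complex.ofReal_pow _ 2).symm

/-- Test the bound on F = ∑ conj(φ(z)) φ: both F(z) and ‖F‖² equal the sum S in question, so S² ≤ M
S. -/
theorem sum_norm_sq_le (hS : IsCompleteOrthonormalSystem (unitBall n) S) {M : ℝ}
    (hM : EvalBound z M) (hM0 : 0 ≤ M) (T : Finset S) : ∑ φ ∈ T, ‖φ.1 z‖ ^ 2 ≤ M := by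
  have h := hM (∑ φ ∈ T, conj (φ.1 z) • ⟨φ.1, hS.subset φ.2⟩)
  rw [hS.norm_sum_smul_sq] at h
  have h1 : (∑ φ ∈ T, conj (φ.1 z) • (⟨φ.1, hS.subset φ.2⟩ : bergmanSpace (unitBall n))).1 z
      = ((∑ φ ∈ T, ‖φ.1 z‖ ^ 2 : ℝ) : ℂ) := by
    rw [Submodule.coe_sum, Finset.sum_apply, Complex.ofReal_sum]
    exact Finset.sum_congr rfl fun φ _ => (Complex.conj_mul' _).trans (Complex.ofReal_pow _ 2).symm
  have h0 : 0 ≤ ∑ φ ∈ T, ‖φ.1 z‖ ^ 2 := Finset.sum_nonneg fun _ _ => sq_nonneg _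
  rw [h1, Complex.norm_real, Real.norm_of_nonneg h0] at h
  simp only [RCLike.norm_conj] at h
  by_contra! hlt
  nlinarith

theorem summable_norm_sq (hS : IsCompleteOrthonormalSystem (unitBall n) S) {M : ℝ}
    (hM : EvalBound z M) (hM0 : 0 ≤ M) : Summable fun φ : S => ‖φ.1 z‖ ^ 2 :=
  summable_of_sum_le (fun _ => sq_nonneg _) (hS.sum_norm_sq_le hM hM0)

theorem tsum_norm_sq_le (hS : IsCompleteOrthonormalSystem (unitBall n) S) {M : ℝ}
    (hM : EvalBound z M) (hM0 : 0 ≤ M) : ∑' φ : S, ‖φ.1 z‖ ^ 2 ≤ M :=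
  Real.tsum_le_of_sum_le (fun _ => sq_nonneg _) (hS.sum_norm_sq_le hM hM0)

/-- Cauchy-Schwarz gives the bound on the span of `S`. The a priori bound `M` makes evaluation
continuous, which carries it to the whole space by density. -/
theorem evalBound_tsum (hS : IsCompleteOrthonormalSystem (unitBall n) S) {M : ℝ}
    (hM : EvalBound z M) (hM0 : 0 ≤ M) : EvalBound z (∑' φ : S, ‖φ.1 z‖ ^ 2) := by
  have hsum := hS.summable_norm_sq hM hM0
  set k : ℝ := ∑' φ : S, ‖φ.1 z‖ ^ 2 with hk
  have hk0 : 0 ≤ k := tsum_nonneg fun _ => sq_nonneg _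
  have hspan : ∀ g ∈ Submodule.span ℂ S, ∃ G : bergmanSpace (unitBall n), G.1 = g ∧
      ‖g z‖ ≤ √k * ‖bergmanToLp (unitBall n) G‖ := by
    intro g hg
    rw [Finsupp.mem_span_iff_linearCombination] at hg
    obtain ⟨c, rfl⟩ := hg
    refine ⟨∑ φ ∈ c.support, c φ • ⟨φ.1, hS.subset φ.2⟩, ?_, ?_⟩
    · rw [Submodule.coe_sum, Finsupp.linearCombination_apply, Finsupp.sum]
      rfl
    · refine abs_le_of_sq_le_sq' ?_ (by positivity) |>.2
      rw [mul_pow, Real.sq_sqrt hk0, hS.norm_sum_smul_sq, Finsupp.linearCombination_apply,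
        Finsupp.sum, Finset.sum_apply]
      calc ‖∑ φ ∈ c.support, (c φ • φ.1) z‖ ^ 2
          ≤ (∑ φ ∈ c.support, ‖φ.1 z‖ * ‖c φ‖) ^ 2 := by
            gcongr
            refine (norm_sum_le _ _).trans_eq (Finset.sum_congr rfl fun φ _ => ?_)
            rw [Pi.smul_apply, norm_smul, mul_comm]
        _ ≤ (∑ φ ∈ c.support, ‖φ.1 z‖ ^ 2) * ∑ φ ∈ c.support, ‖c φ‖ ^ 2 :=
            Finset.sum_mul_sq_le_sq_mul_sq _ _ _
        _ ≤ k * ∑ φ ∈ c.support, ‖c φ‖ ^ 2 := by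
            gcongr
            exact hsum.sum_le_tsum _ fun _ _ => sq_nonneg _
  intro f
  have hle : ‖f.1 z‖ ≤ √k * ‖bergmanToLp (unitBall n) f‖ := by
    refine le_of_forall_pos_le_add fun ε hε => ?_
    set δ : ℝ := ε / (√k + √M + 1) with hδ
    have hden : 0 < √k + √M + 1 := by positivity
    have hδ0 : 0 < δ := by positivity
    obtain ⟨g, hg, hfg⟩ := hS.complete f.1 f.2 (ENNReal.ofReal δ) (ENNReal.ofReal_pos.2 hδ0)
    obtain ⟨G, rfl, hG⟩ := hspan g hg
    have hnorm : ‖bergmanToLp (unitBall n) (f - G)‖ ≤ δ := by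
      have h1 : ‖bergmanToLp (unitBall n) (f - G)‖
          = (eLpNorm (f.1 - G.1) 2 (volume.restrict (unitBall n))).toReal :=
        Lp.norm_toLp _ (f - G).2.2
      rw [h1]
      exact ENNReal.toReal_le_of_le_ofReal hδ0.le hfg.le
    have h2 : ‖f.1 z - G.1 z‖ ≤ √M * δ := by
      have h3 := hM (f - G)
      rw [← Real.sq_sqrt hM0, ← mul_pow] at h3
      refine (abs_le_of_sq_le_sq' h3 (by positivity)).2.trans ?_
      gcongr
    have h4 : ‖bergmanToLp (unitBall n) G‖ ≤ ‖bergmanToLp (unitBall n) f‖ + δ := by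
      have h5 : bergmanToLp (unitBall n) G
          = bergmanToLp (unitBall n) f - bergmanToLp (unitBall n) (f - G) := by
        rw [map_sub]
        abel
      rw [h5]
      exact (norm_sub_le _ _).trans (by linarith)
    have h6 : (√k + √M + 1) * δ = ε := by
      rw [hδ]
      field_simp
    calc ‖f.1 z‖ = ‖G.1 z + (f.1 z - G.1 z)‖ := by congr 1; ring
      _ ≤ ‖G.1 z‖ + ‖f.1 z - G.1 z‖ := norm_add_le _ _
      _ ≤ √k * (‖bergmanToLp (unitBall n) f‖ + δ) + √M * δ := by
          refine add_le_add (hG.trans ?_) h2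
          gcongr
      _ ≤ √k * ‖bergmanToLp (unitBall n) f‖ + ε := by linarith
  calc ‖f.1 z‖ ^ 2 ≤ (√k * ‖bergmanToLp (unitBall n) f‖) ^ 2 := by gcongr
    _ = k * ‖bergmanToLp (unitBall n) f‖ ^ 2 := by rw [mul_pow, Real.sq_sqrt hk0]

/-- The sum is the least evaluation bound at its point, so transport from 0 to `w` and back gives
the two inequalities. -/
theorem tsum_norm_sq_eq (hS : IsCompleteOrthonormalSystem (unitBall n) S) (hw : ‖w‖ < 1) :
    ∑' φ : S, ‖φ.1 w‖ ^ 2 = (∑' φ : S, ‖φ.1 0‖ ^ 2) / (1 - ‖w‖ ^ 2) ^ (n + 1) := by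
  have hpos : 0 < (1 - ‖w‖ ^ 2) ^ (n + 1) := pow_pos (by nlinarith [norm_nonneg w]) _
  have h0 := hS.evalBound_tsum evalBound_zero (by positivity)
  have h00 : 0 ≤ ∑' φ : S, ‖φ.1 0‖ ^ 2 := tsum_nonneg fun _ => sq_nonneg _
  have hw1 := h0.of_zero h00 hw
  have hw10 : 0 ≤ (∑' φ : S, ‖φ.1 0‖ ^ 2) / (1 - ‖w‖ ^ 2) ^ (n + 1) := by positivity
  refine le_antisymm (hS.tsum_norm_sq_le hw1 hw10) ?_
  have hw0 : 0 ≤ ∑' φ : S, ‖φ.1 w‖ ^ 2 := tsum_nonneg fun _ => sq_nonneg _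
  rw [div_le_iff₀ hpos]
  exact hS.tsum_norm_sq_le ((hS.evalBound_tsum hw1 hw10).to_zero hw0 hw) (by positivity)

theorem tsum_norm_zero_sq_pos (hS : IsCompleteOrthonormalSystem (unitBall n) S) :
    0 < ∑' φ : S, ‖φ.1 0‖ ^ 2 := by
  have h0 := hS.evalBound_tsum evalBound_zero (by positivity)
  have h1 : (fun _ => 1 : Cn n → ℂ) ∈ bergmanSpace (unitBall n) := by
    rw [mem_bergmanSpace_iff isOpen_unitBall]
    refine ⟨differentiableOn_const _, ?_⟩
    simpa using volume_unitBall_ne_top.lt_top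
  have h2 := h0 ⟨_, h1⟩
  by_contra! hle
  have := mul_nonpos_of_nonpos_of_nonneg hle
    (sq_nonneg ‖bergmanToLp (unitBall n) ⟨_, h1⟩‖)
  simp only [norm_one, one_pow] at h2
  linarith

end IsCompleteOrthonormalSystem

theorem exists_bergmanKernel_unitBall_eq (n : ℕ) : ∃ c > 0, ∀ w ∈ unitBall n,
    (bergmanKernel (unitBall n) w w).re = c / (1 - ‖w‖ ^ 2) ^ (n + 1) := by
  have hS := (exists_isCompleteOrthonormalSystem (unitBall n)).choose_spec
  refine ⟨_, hS.tsum_norm_zero_sq_pos, fun w hw => ?_⟩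
  rw [← hS.tsum_norm_sq_eq (mem_unitBall.1 hw), bergmanKernel, ← Complex.ofReal_re (tsum _),
    Complex.ofReal_tsum]
  congr 2
  ext φ
  rw [Complex.mul_conj']
  push_cast
  rfl

theorem bergmanMetric_unitBall (hz : z ∈ unitBall n) (v : Cn n) :
    bergmanMetric (unitBall n) z v = (n + 1) *
      (‖v‖ ^ 2 / (1 - ‖z‖ ^ 2) + ‖inner ℂ z v‖ ^ 2 / (1 - ‖z‖ ^ 2) ^ 2) := by
  obtain ⟨c, hc, hK⟩ := exists_bergmanKernel_unitBall_eq n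
  have hsum : ∀ w : Cn n, 1 + -1 * ∑ j, ‖w j‖ ^ 2 = 1 - ‖w‖ ^ 2 := fun w => by
    rw [EuclideanSpace.norm_sq_eq]
    ring
  have hpos : ∀ w ∈ unitBall n, 0 < 1 + -1 * ∑ j, ‖w j‖ ^ 2 := fun w hw => by
    rw [hsum]
    nlinarith [norm_nonneg w, mem_unitBall.1 hw]
  -- The unknown constant only adds log c, which the Levi form annihilates.
  have hlog : (fun w => Real.log (bergmanKernel (unitBall n) w w).re) =ᶠ[nhds z]
      fun w => Real.log c + (-(n + 1 : ℝ)) * Real.log (1 + -1 * ∑ j, ‖w j‖ ^ 2) := by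
    filter_upwards [isOpen_unitBall.mem_nhds hz] with w hw
    have hp := hpos w hw
    rw [hK w hw, ← hsum, Real.log_div hc.ne' (by positivity), Real.log_pow]
    push_cast
    ring
  have hcoord : ∀ j x, HasFDerivAt (fun w : Cn n => w j)
      (EuclideanSpace.proj j : Cn n →L[ℂ] ℂ) x :=
    fun j x => (EuclideanSpace.proj j : Cn n →L[ℂ] ℂ).hasFDerivAt
  rw [bergmanMetric, leviForm_congr hlog, leviForm_const_add_mul,
    leviForm_log_one_add_mul_sum isOpen_unitBall (u := fun j w => w j)
      (fun j x _ => (hcoord j x).differentiableAt.differentiableWithinAt) (-1) hpos hz v]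
  simp only [(hcoord _ _).fderiv, hsum, PiLp.proj_apply]
  rw [← EuclideanSpace.norm_sq_eq, PiLp.inner_apply]
  simp only [RCLike.inner_apply, mul_comm (v _)]
  ring

end BergmanKernel

/-! ### Arzelà-Ascoli, the Riemann sphere and Hurwitz's theorem. -/

section NormalFamilies

/-- In the topology of pointwise convergence this is a closed subset of a Tychonoff product. -/
theorem isCompact_setOf_locally_lipschitz {X Y : Type*} [PseudoMetricSpace X] [MetricSpace Y]
    {Q : Set Y} (hQ : IsCompact Q) (r L : X → ℝ) :
    IsCompact {g : X → Y | (∀ x, g x ∈ Q) ∧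
      ∀ x y, dist y x < r x → dist (g y) (g x) ≤ L x * dist y x} := by
  refine (isCompact_univ_pi fun _ : X => hQ).of_isClosed_subset ?_ fun g hg x _ => hg.1 x
  simp only [ofPred_and, ofPred_forall]
  refine IsClosed.inter (isClosed_iInter fun x => hQ.isClosed.preimage (continuous_apply x)) ?_
  refine isClosed_iInter fun x => isClosed_iInter fun y => isClosed_iInter fun _ => ?_
  exact isClosed_le ((continuous_apply y).dist (continuous_apply x)) continuous_const

/-- A sequential version of the Arzela-Ascoli theorem. -/
theorem exists_subseq_tendsto_of_locally_lipschitz {X Y : Type*} [PseudoMetricSpace X]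
    [LocallyCompactSpace X] [SigmaCompactSpace X] [MetricSpace Y] {Q : Set Y} (hQ : IsCompact Q)
    {r L : X → ℝ} (hr : ∀ x, 0 < r x) (u : ℕ → X → Y) (huQ : ∀ j x, u j x ∈ Q)
    (hu : ∀ j x y, dist y x < r x → dist (u j y) (u j x) ≤ L x * dist y x) :
    ∃ φ : C(X, Y), ∃ k : ℕ → ℕ, StrictMono k ∧
      ∀ K, IsCompact K → TendstoUniformlyOn (fun j => u (k j)) φ atTop K := by
  set A : Set (X → Y) := {g | (∀ x, g x ∈ Q) ∧
    ∀ x y, dist y x < r x → dist (g y) (g x) ≤ L x * dist y x} with hA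
  have hcont : ∀ g ∈ A, Continuous g := fun g hg => continuous_iff_continuousAt.2 fun x =>
    continuousAt_of_locally_lipschitz (hr x) (L x) (hg.2 x)
  set S : Set C(X, Y) := {g | ⇑g ∈ A} with hS
  have himg : ContinuousMap.toFun '' S = A := by
    ext g
    constructor
    · rintro ⟨g, hg, rfl⟩
      exact hg
    · intro hg
      exact ⟨⟨g, hcont g hg⟩, hg, rfl⟩
  have hcomp : IsCompact S := by
    refine ArzelaAscoli.isCompact_of_equicontinuous S
      (himg ▸ isCompact_setOf_locally_lipschitz hQ r L) fun x => ?_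
    refine Metric.equicontinuousAt_of_continuity_modulus (fun y => L x * dist y x) ?_ _ ?_
    · have h : Continuous fun y => L x * dist y x := by fun_prop
      simpa using h.tendsto x
    · filter_upwards [Metric.ball_mem_nhds x (hr x)] with y hy g
      rw [dist_comm]
      exact g.2.2 x y hy
  obtain ⟨φ, -, k, hk, hlim⟩ := hcomp.tendsto_subseq
    (x := fun j => ⟨u j, hcont _ ⟨huQ j, hu j⟩⟩) fun j => ⟨huQ j, hu j⟩
  exact ⟨φ, k, hk, fun K hK => ContinuousMap.tendsto_iff_forall_isCompact_tendstoUniformlyOn.1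
    hlim K hK⟩

theorem exists_subseq_tendstoUniformlyOn_of_locally_lipschitz {E Y : Type*} [MetricSpace E]
    [ProperSpace E] [MetricSpace Y] {Ω : Set E} (hΩ : IsOpen Ω) {Q : Set Y} (hQ : IsCompact Q)
    {r L : E → ℝ} (hr : ∀ x ∈ Ω, 0 < r x) (u : ℕ → E → Y) (huQ : ∀ j, ∀ x ∈ Ω, u j x ∈ Q)
    (hu : ∀ j, ∀ x ∈ Ω, ∀ y ∈ Ω, dist y x < r x → dist (u j y) (u j x) ≤ L x * dist y x) :
    ∃ P : E → Y, ∃ k : ℕ → ℕ, StrictMono k ∧ ContinuousOn P Ω ∧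
      ∀ K ⊆ Ω, IsCompact K → TendstoUniformlyOn (fun j => u (k j)) P atTop K := by
  have : LocallyCompactSpace Ω := hΩ.locallyCompactSpace
  obtain ⟨φ, k, hk, hlim⟩ := exists_subseq_tendsto_of_locally_lipschitz (X := Ω) hQ
    (r := fun x => r x) (L := fun x => L x) (fun x => hr x x.2) (fun j x => u j x)
    (fun j x => huQ j x x.2) fun j x y h => hu j x x.2 y y.2 h
  have hP : ∀ x : Ω, Function.extend Subtype.val φ (u 0) x = φ x :=
    Subtype.val_injective.extend_apply φ (u 0)
  -- Off Ω the limit takes the values of `u 0`, an arbitrary default.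
  refine ⟨Function.extend Subtype.val φ (u 0), k, hk, ?_, fun K hKΩ hK => ?_⟩
  · rw [continuousOn_iff_continuous_domRestrict]
    exact φ.continuous.congr fun x => (hP x).symm
  · have h := hlim (Subtype.val ⁻¹' K) (Topology.IsInducing.subtypeVal.isCompact_preimage_iff
      (by simpa using hKΩ) |>.2 hK)
    rw [Metric.tendstoUniformlyOn_iff] at h ⊢
    intro ε hε
    filter_upwards [h ε hε] with j hj x hx
    have := hj ⟨x, hKΩ hx⟩ hx
    rwa [← hP] at this

/-- A chart of the Riemann sphere: an affine copy of the inverse stereographic projection. -/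
noncomputable def sphereEmbedding (w : ℂ) : ℂ × ℝ := ((1 + ‖w‖ ^ 2)⁻¹ • w, (1 + ‖w‖ ^ 2)⁻¹)

theorem one_add_norm_sq_pos (w : ℂ) : 0 < 1 + ‖w‖ ^ 2 := by positivity

theorem norm_sphereEmbedding_le (w : ℂ) : ‖sphereEmbedding w‖ ≤ 1 := by
  have h := one_add_norm_sq_pos w
  refine max_le ?_ ?_
  · rw [sphereEmbedding, norm_smul, norm_inv, Real.norm_of_nonneg h.le, inv_mul_le_one₀ h]
    nlinarith [sq_nonneg (‖w‖ - 1), norm_nonneg w]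
  · rw [sphereEmbedding, norm_inv, Real.norm_of_nonneg h.le]
    exact inv_le_one_of_one_le₀ (by nlinarith [norm_nonneg w])

theorem sphereEmbedding_snd_mem (w : ℂ) : (sphereEmbedding w).2 ∈ Icc (0 : ℝ) 1 := by
  have h := one_add_norm_sq_pos w
  exact ⟨(inv_pos.2 h).le, inv_le_one_of_one_le₀ (by nlinarith [norm_nonneg w])⟩

/-- The equation of the sphere containing the image; its point with second coordinate 0 represents
∞. -/
theorem norm_sphereEmbedding_fst_sq (w : ℂ) : ‖(sphereEmbedding w).1‖ ^ 2
    = (sphereEmbedding w).2 * (1 - (sphereEmbedding w).2) := by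
  have h := one_add_norm_sq_pos w
  simp only [sphereEmbedding]
  rw [norm_smul, norm_inv, Real.norm_of_nonneg h.le]
  field_simp
  ring

theorem sphereEmbedding_snd_inv_smul_fst (w : ℂ) :
    (sphereEmbedding w).2⁻¹ • (sphereEmbedding w).1 = w := by
  have h := one_add_norm_sq_pos w
  simp only [sphereEmbedding]
  rw [smul_smul, inv_mul_cancel₀ (inv_ne_zero h.ne'), one_smul]

/-- The coordinate 1/w near ∞. It also holds at w = 0, where both sides are 0 by the convention for
inverses. -/
theorem one_sub_sphereEmbedding_snd_inv_smul_conj (w : ℂ) :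
    (1 - (sphereEmbedding w).2)⁻¹ • conj (sphereEmbedding w).1 = w⁻¹ := by
  have h := one_add_norm_sq_pos w
  rcases eq_or_ne w 0 with rfl | hw
  · simp [sphereEmbedding]
  have hw' : (‖w‖ : ℝ) ≠ 0 := norm_ne_zero_iff.2 hw
  have h1 : (1 - (sphereEmbedding w).2)⁻¹ * (1 + ‖w‖ ^ 2)⁻¹ = (‖w‖ ^ 2)⁻¹ := by
    simp only [sphereEmbedding]
    rw [← mul_inv]
    congr 1
    field_simp
    ring
  rw [Complex.inv_def, Complex.normSq_eq_norm_sq, ← h1]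
  simp only [sphereEmbedding, Complex.real_smul, map_mul, Complex.conj_ofReal]
  push_cast
  ring

/-- The chordal metric is dominated by the spherical one. -/
theorem hasFDerivAt_sphereEmbedding (w : ℂ) : ∃ D : ℂ →L[ℝ] ℂ × ℝ,
    HasFDerivAt sphereEmbedding D w ∧ ‖D‖ ≤ 3 / (1 + ‖w‖ ^ 2) := by
  have h := one_add_norm_sq_pos w
  set a : ℝ := (1 + ‖w‖ ^ 2)⁻¹ with ha
  have ha0 : 0 < a := inv_pos.2 h
  have haw : a * (1 + ‖w‖ ^ 2) = 1 := inv_mul_cancel₀ h.ne'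
  have h1 : HasFDerivAt (fun w : ℂ => 1 + ‖w‖ ^ 2) (2 • innerSL ℝ w) w :=
    (hasStrictFDerivAt_norm_sq w).hasFDerivAt.const_add 1
  have h2 : HasFDerivAt (fun w : ℂ => (1 + ‖w‖ ^ 2)⁻¹)
      (-((1 + ‖w‖ ^ 2) ^ 2)⁻¹ • (2 • innerSL ℝ w)) w :=
    (hasDerivAt_inv h.ne').comp_hasFDerivAt_of_eq w h1 rfl
  refine ⟨_, (h2.fun_smul (hasFDerivAt_id w)).prodMk h2, ?_⟩
  rw [div_eq_mul_inv, ← ha]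
  -- With a = 1/(1 + |w|²), the second component has derivative at most 2a²|w| ≤ a and the first at
  -- most a + 2a²|w|² ≤ 3a; hence the constant 3.
  have hb : ‖-((1 + ‖w‖ ^ 2) ^ 2)⁻¹ • (2 • innerSL ℝ w)‖ ≤ 2 * a ^ 2 * ‖w‖ := by
    rw [← inv_pow, ← ha, norm_smul, norm_neg, norm_pow, Real.norm_of_nonneg ha0.le]
    have : ‖(2 • innerSL ℝ w : ℂ →L[ℝ] ℝ)‖ ≤ 2 * ‖w‖ := by
      refine (norm_nsmul_le).trans ?_
      rw [innerSL_apply_norm]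
      norm_num
    nlinarith [sq_nonneg a]
  have hb2 : 2 * a ^ 2 * ‖w‖ ≤ a := by
    have : 2 * ‖w‖ ≤ 1 + ‖w‖ ^ 2 := by nlinarith [sq_nonneg (‖w‖ - 1)]
    nlinarith [mul_le_mul_of_nonneg_left this (sq_nonneg a)]
  have hb3 : 2 * a ^ 2 * ‖w‖ * ‖w‖ ≤ 2 * a := by nlinarith [sq_nonneg a]
  refine ContinuousLinearMap.opNorm_le_bound _ (by positivity) fun v => ?_
  refine max_le ?_ ?_
  · refine (ContinuousLinearMap.le_opNorm _ v).trans
      (mul_le_mul_of_nonneg_right ?_ (norm_nonneg v))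
    refine (norm_add_le _ _).trans ?_
    rw [ContinuousLinearMap.norm_smulRight_apply, norm_smul, Real.norm_of_nonneg ha0.le]
    have h4 := ContinuousLinearMap.norm_id_le (𝕜 := ℝ) (E := ℂ)
    have h5 := mul_le_mul_of_nonneg_right hb (norm_nonneg w)
    have h6 := mul_le_mul_of_nonneg_left h4 ha0.le
    simp only [id] at *
    linarith
  · refine (ContinuousLinearMap.le_opNorm _ v).trans
      (mul_le_mul_of_nonneg_right ?_ (norm_nonneg v))
    linarith

/-- A zero of the limit of a sequence of holomorphic functions without zeros forces the limit to
vanish identically. -/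
theorem eqOn_zero_of_tendstoUniformlyOn_ne_zero {G : ℕ → ℂ → ℂ} {g : ℂ → ℂ} {R : ℝ} (hR : 0 < R)
    (hG : ∀ᶠ j in atTop, DifferentiableOn ℂ (G j) (Metric.ball 0 R))
    (hG0 : ∀ᶠ j in atTop, ∀ ζ ∈ Metric.ball (0 : ℂ) R, G j ζ ≠ 0)
    (hlim : TendstoUniformlyOn G g atTop (Metric.ball 0 R)) (hg0 : g 0 = 0) :
    EqOn g 0 (Metric.ball 0 R) := by
  have hg : DifferentiableOn ℂ g (Metric.ball 0 R) :=
    hlim.tendstoLocallyUniformlyOn.differentiableOn hG Metric.isOpen_ball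
  have hgan := hg.analyticOnNhd Metric.isOpen_ball
  have h0 : (0 : ℂ) ∈ Metric.ball (0 : ℂ) R := Metric.mem_ball_self hR
  rcases (hgan 0 h0).eventually_eq_zero_or_eventually_ne_zero with h | h
  · exact hgan.eqOn_zero_of_preconnected_of_eventuallyEq_zero
      (convex_ball 0 R).isPreconnected h0 h
  exfalso
  rw [eventually_nhdsWithin_iff, Metric.eventually_nhds_iff] at h
  obtain ⟨s, hs, hne⟩ := h
  set ρ : ℝ := min s R / 2 with hρ
  have hm : 0 < min s R := lt_min hs hR
  have hρ0 : 0 < ρ := by positivity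
  have hρs : ρ < s := by linarith [min_le_left s R]
  have hρR : ρ < R := by linarith [min_le_right s R]
  have hsub : Metric.closedBall (0 : ℂ) ρ ⊆ Metric.ball 0 R := Metric.closedBall_subset_ball hρR
  have hsph : Metric.sphere (0 : ℂ) ρ ⊆ Metric.ball 0 R :=
    Metric.sphere_subset_closedBall.trans hsub
  obtain ⟨δ, hδ, hδle⟩ := (isCompact_sphere (0 : ℂ) ρ).exists_forall_le'
    (hg.continuousOn.mono hsph).norm (a := 0) (by
      intro ζ hζ
      rw [mem_sphere_zero_iff_norm] at hζ
      refine norm_pos_iff.2 (hne (by simpa [hζ] using hρs) ?_)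
      rintro rfl
      rw [norm_zero] at hζ
      exact hρ0.ne hζ)
  obtain ⟨j, hj, hjd, hj0⟩ := ((Metric.tendstoUniformlyOn_iff.1 hlim (δ / 2) (by positivity)).and
    (hG.and hG0)).exists
  -- If 0 were an isolated zero of `g`, then |G j| ≥ δ/2 on a small circle while |G j 0| < δ/2,
  -- against the maximum principle for 1/G j.
  have hfr : ∀ ζ ∈ frontier (Metric.ball (0 : ℂ) ρ), ‖(G j ζ)⁻¹‖ ≤ (δ / 2)⁻¹ := by
    intro ζ hζ
    rw [frontier_ball _ hρ0.ne'] at hζ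
    have h1 := hj ζ (hsph hζ)
    have h2 := hδle ζ hζ
    rw [dist_eq_norm] at h1
    have h3 := norm_sub_norm_le (g ζ) (G j ζ)
    rw [norm_inv]
    exact inv_anti₀ (by positivity) (by linarith)
  have hdc : DiffContOnCl ℂ (fun ζ => (G j ζ)⁻¹) (Metric.ball 0 ρ) := by
    refine DifferentiableOn.diffContOnCl ?_
    rw [closure_ball _ hρ0.ne']
    exact (hjd.mono hsub).fun_inv fun ζ hζ => hj0 ζ (hsub hζ)
  have h5 := Complex.norm_le_of_forall_mem_frontier_norm_le Metric.isBounded_ball hdc hfr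
    (subset_closure (Metric.mem_ball_self hρ0))
  have h6 := hj 0 h0
  rw [hg0, dist_zero_left] at h6
  rw [norm_inv] at h5
  have h7 : 0 < ‖G j 0‖ := norm_pos_iff.2 (hj0 0 h0)
  have h8 := (inv_le_inv₀ h7 (by positivity)).1 h5
  linarith

end NormalFamilies

/-! ### Marty's criterion. -/

section Marty

/-- The model of the Riemann sphere in which `sphereEmbedding` takes its values. -/
def sphereModel : Set (ℂ × ℝ) :=
  Metric.closedBall 0 1 ∩ {y | y.2 ∈ Icc (0 : ℝ) 1 ∧ ‖y.1‖ ^ 2 = y.2 * (1 - y.2)}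

theorem isCompact_sphereModel : IsCompact sphereModel := by
  refine (isCompact_closedBall 0 1).inter_right (IsClosed.inter ?_ ?_)
  · exact isClosed_Icc.preimage continuous_snd
  · exact isClosed_eq (by fun_prop) (by fun_prop)

theorem sphereEmbedding_mem_sphereModel (w : ℂ) : sphereEmbedding w ∈ sphereModel :=
  ⟨mem_closedBall_zero_iff.2 (norm_sphereEmbedding_le w), sphereEmbedding_snd_mem w,
    norm_sphereEmbedding_fst_sq w⟩

theorem abs_snd_sub_snd_le_dist (x y : ℂ × ℝ) : |x.2 - y.2| ≤ dist x y := by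
  rw [Prod.dist_eq, ← Real.dist_eq]
  exact le_max_right _ _

variable {E : Type*} [NormedAddCommGroup E] [NormedSpace ℂ E]

/-- The mean value inequality: the factor 1 + |F|² in the hypothesis cancels against the derivative
of `sphereEmbedding`. -/
theorem dist_sphereEmbedding_comp_le {s : Set E} (hs : IsOpen s) (hconv : Convex ℝ s) {F : E → ℂ}
    (hF : DifferentiableOn ℂ F s) {M : ℝ}
    (hM : ∀ y ∈ s, ‖fderiv ℂ F y‖ ≤ M * (1 + ‖F y‖ ^ 2)) {x y : E} (hx : x ∈ s) (hy : y ∈ s) :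
    dist (sphereEmbedding (F y)) (sphereEmbedding (F x)) ≤ 3 * M * dist y x := by
  choose D hD hDn using hasFDerivAt_sphereEmbedding
  rw [dist_eq_norm, dist_eq_norm]
  refine hconv.norm_image_sub_le_of_norm_hasFDerivWithin_le
    (f := fun y => sphereEmbedding (F y))
    (f' := fun y => (D (F y)).comp ((fderiv ℂ F y).restrictScalars ℝ))
    (fun y hy => ?_) (fun y hy => ?_) hx hy
  · exact ((hD (F y)).comp y ((hF.differentiableAt
      (hs.mem_nhds hy)).hasFDerivAt.restrictScalars ℝ)).hasFDerivWithinAt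
  · refine (ContinuousLinearMap.opNorm_comp_le _ _).trans ?_
    rw [ContinuousLinearMap.norm_restrictScalars]
    have h := one_add_norm_sq_pos (F y)
    calc ‖D (F y)‖ * ‖fderiv ℂ F y‖
        ≤ 3 / (1 + ‖F y‖ ^ 2) * (M * (1 + ‖F y‖ ^ 2)) :=
          mul_le_mul (hDn _) (hM y hy) (norm_nonneg _) (by positivity)
      _ = 3 * M := by field_simp

variable [FiniteDimensional ℂ E]

/-- The set where the spherical limit of a sequence of holomorphic functions is `∞` is open. -/
theorem exists_ball_subset_of_snd_eq_zero {Ω : Set E} (hΩ : IsOpen Ω) {F : ℕ → E → ℂ}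
    (hF : ∀ j, DifferentiableOn ℂ (F j) Ω) {P : E → ℂ × ℝ} (hP : ContinuousOn P Ω)
    (hPS : ∀ x ∈ Ω, P x ∈ sphereModel)
    (hlim : ∀ K ⊆ Ω, IsCompact K →
      TendstoUniformlyOn (fun j x => sphereEmbedding (F j x)) P atTop K)
    {z : E} (hz : z ∈ Ω) (hz0 : (P z).2 = 0) :
    ∃ ρ > 0, Metric.ball z ρ ⊆ {x ∈ Ω | (P x).2 = 0} := by
  have : ProperSpace E := FiniteDimensional.proper ℂ E
  have hfst : ∀ y ∈ sphereModel, y.2 = 0 → y.1 = 0 := fun y hy h0 => by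
    have := hy.2.2
    rw [h0, zero_mul] at this
    exact norm_eq_zero.1 (pow_eq_zero_iff two_ne_zero |>.1 this)
  -- The limit below 1/4 forces the second coordinates of the sequence below 1/2 eventually, keeping
  -- both away from 1, where the coordinate at ∞ is singular.
  have hnhds : Ω ∩ {x | (P x).2 < 1 / 4} ∈ nhds z := by
    refine inter_mem (hΩ.mem_nhds hz) ?_
    have hc : ContinuousAt (fun x => (P x).2) z :=
      continuous_snd.continuousAt.comp (hP.continuousAt (hΩ.mem_nhds hz))
    exact hc.eventually_lt continuousAt_const (by rw [hz0]; norm_num)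
  obtain ⟨ρ, hρ, hsub⟩ := Metric.nhds_basis_closedBall.mem_iff.1 hnhds
  have hKΩ : Metric.closedBall z ρ ⊆ Ω := fun x hx => (hsub hx).1
  have hlimK := hlim _ hKΩ (isCompact_closedBall z ρ)
  have hhalf : ∀ᶠ j in atTop, ∀ x ∈ Metric.closedBall z ρ,
      (sphereEmbedding (F j x)).2 ≤ 1 / 2 := by
    filter_upwards [Metric.tendstoUniformlyOn_iff.1 hlimK (1 / 4) (by norm_num)] with j hj x hx
    have h1 := (abs_snd_sub_snd_le_dist _ _).trans_lt (hj x hx)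
    have h2 : (P x).2 < 1 / 4 := (hsub hx).2
    linarith [(abs_lt.1 h1).1]
  have hne : ∀ᶠ j in atTop, ∀ x ∈ Metric.closedBall z ρ, F j x ≠ 0 := by
    filter_upwards [hhalf] with j hj x hx h0
    have := hj x hx
    rw [h0] at this
    norm_num [sphereEmbedding] at this
  set Q : Set (ℂ × ℝ) := sphereModel ∩ {y | y.2 ≤ 1 / 2}
  set H : ℂ × ℝ → ℂ := fun y => (1 - y.2)⁻¹ • conj y.1 with hH
  have hHQ : UniformContinuousOn H Q := by
    refine (isCompact_sphereModel.inter_right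
      (isClosed_le continuous_snd continuous_const)).uniformContinuousOn_of_continuous ?_
    have hc : ContinuousOn (fun y : ℂ × ℝ => 1 - y.2) Q := by fun_prop
    refine (hc.inv₀ fun y hy => ?_).smul
      (Complex.continuous_conj.comp continuous_fst).continuousOn
    have : y.2 ≤ 1 / 2 := hy.2
    linarith
  have hHlim : TendstoUniformlyOn (fun j x => (F j x)⁻¹) (fun x => H (P x)) atTop
      (Metric.closedBall z ρ) := by
    have h := UniformContinuousOn.comp_tendstoUniformlyOn_eventually (s := Q)
      (F := fun j x => sphereEmbedding (F j x)) (f := P) (p := atTop) (t := Metric.closedBall z ρ)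
      (hhalf.mono fun j hj x hx => ⟨sphereEmbedding_mem_sphereModel _, hj x hx⟩)
      (fun x hx => ⟨hPS x (hKΩ hx), by
        have : (P x).2 < 1 / 4 := (hsub hx).2
        change (P x).2 ≤ 1 / 2
        linarith⟩) hHQ hlimK
    simpa only [hH, one_sub_sphereEmbedding_snd_inv_smul_conj] using h
  refine ⟨ρ, hρ, fun x hx => ⟨hKΩ (Metric.ball_subset_closedBall hx), ?_⟩⟩
  rcases eq_or_ne x z with rfl | hxz
  · exact hz0
  have hnorm : 0 < ‖x - z‖ := norm_pos_iff.2 (sub_ne_zero.2 hxz)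
  have hR : 0 < ρ / ‖x - z‖ := by positivity
  -- Restriction to the complex line through `z` and `x` reduces to one variable; the parameter 1
  -- corresponds to `x`.
  have hmaps : MapsTo (fun ζ : ℂ => z + ζ • (x - z)) (Metric.ball 0 (ρ / ‖x - z‖))
      (Metric.closedBall z ρ) := by
    intro ζ hζ
    rw [mem_ball_zero_iff, lt_div_iff₀ hnorm] at hζ
    rw [mem_closedBall_iff_norm, add_sub_cancel_left, norm_smul]
    exact hζ.le
  have hline : Differentiable ℂ fun ζ : ℂ => z + ζ • (x - z) :=
    (differentiable_id.smul_const _).const_add _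
  have hzero := eqOn_zero_of_tendstoUniformlyOn_ne_zero hR
    (G := fun j ζ => (F j (z + ζ • (x - z)))⁻¹) (g := fun ζ => H (P (z + ζ • (x - z))))
    (hne.mono fun j hj => (((hF j).comp hline.differentiableOn
      (hmaps.mono_right hKΩ)).fun_inv fun ζ hζ => hj _ (hmaps hζ)))
    (hne.mono fun j hj ζ hζ => inv_ne_zero (hj _ (hmaps hζ)))
    ((hHlim.comp _).mono hmaps)
    (by simp [hH, hfst _ (hPS z hz) hz0])
  have h1 : (1 : ℂ) ∈ Metric.ball (0 : ℂ) (ρ / ‖x - z‖) := by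
    rw [mem_ball_zero_iff, norm_one, lt_div_iff₀ hnorm, one_mul]
    exact mem_ball_iff_norm.1 hx
  have h2 := hzero h1
  have hlt : (P x).2 < 1 / 4 := (hsub (Metric.ball_subset_closedBall hx)).2
  simp only [hH, one_smul, add_sub_cancel, Pi.zero_apply, smul_eq_zero, inv_eq_zero,
    map_eq_zero] at h2
  have h3 : (P x).1 = 0 := h2.resolve_left (by linarith)
  have h4 := (hPS x (hKΩ (Metric.ball_subset_closedBall hx))).2.2
  rw [h3, norm_zero, zero_pow two_ne_zero] at h4
  exact (mul_eq_zero.1 h4.symm).resolve_right (by linarith)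

/-- **Marty's criterion**: a sequence of holomorphic functions whose spherical derivatives are
locally bounded has a subsequence that converges locally uniformly, possibly to `∞`. -/
theorem exists_subseq_of_spherical_derivative_le {Ω : Set E} (hΩ : IsOpen Ω)
    (hconn : IsPreconnected Ω) {F : ℕ → E → ℂ} (hF : ∀ j, DifferentiableOn ℂ (F j) Ω)
    {r M : E → ℝ} (hr : ∀ x ∈ Ω, 0 < r x) (hball : ∀ x ∈ Ω, Metric.ball x (r x) ⊆ Ω)
    (hM : ∀ j, ∀ x ∈ Ω, ∀ y ∈ Metric.ball x (r x),
      ‖fderiv ℂ (F j) y‖ ≤ M x * (1 + ‖F j y‖ ^ 2)) :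
    ∃ k : ℕ → ℕ, StrictMono k ∧
      ((∃ f : E → ℂ, ∀ K ⊆ Ω, IsCompact K →
          TendstoUniformlyOn (fun j => F (k j)) f atTop K) ∨
        (∀ K ⊆ Ω, IsCompact K → ∀ B : ℝ, ∀ᶠ j in atTop, ∀ z ∈ K, B < ‖F (k j) z‖)) := by
  have : ProperSpace E := FiniteDimensional.proper ℂ E
  obtain ⟨P, k, hk, hP, hlim⟩ := exists_subseq_tendstoUniformlyOn_of_locally_lipschitz hΩ
    isCompact_sphereModel (L := fun x => 3 * M x) hr (fun j x => sphereEmbedding (F j x))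
    (fun j x _ => sphereEmbedding_mem_sphereModel _) fun j x hx y _ hxy =>
      dist_sphereEmbedding_comp_le Metric.isOpen_ball (convex_ball x (r x))
        ((hF j).mono (hball x hx)) (hM j x hx) (Metric.mem_ball_self (hr x hx)) hxy
  have hPS : ∀ x ∈ Ω, P x ∈ sphereModel := fun x hx =>
    isCompact_sphereModel.isClosed.mem_of_tendsto
      ((hlim {x} (by simpa using hx) isCompact_singleton).tendsto_at (mem_singleton x))
      (Eventually.of_forall fun j => sphereEmbedding_mem_sphereModel _)
  refine ⟨k, hk, ?_⟩
  -- The points with limit ∞ and those with finite limit form two disjoint open sets covering Ω, so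
  -- one of them is everything.
  have hopen0 : IsOpen {x ∈ Ω | (P x).2 = 0} := Metric.isOpen_iff.2 fun z hz =>
    exists_ball_subset_of_snd_eq_zero hΩ (fun j => hF (k j)) hP hPS hlim hz.1 hz.2
  have hopen1 : IsOpen {x ∈ Ω | (P x).2 ≠ 0} :=
    (continuous_snd.comp_continuousOn hP).isOpen_inter_preimage hΩ isOpen_compl_singleton
  have hdisj : Disjoint {x ∈ Ω | (P x).2 ≠ 0} {x ∈ Ω | (P x).2 = 0} :=
    disjoint_left.2 fun x hx hx' => hx.2 hx'.2
  rcases hconn.subset_or_subset hopen1 hopen0 hdisj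
    (fun x hx => (em ((P x).2 = 0)).symm.imp (⟨hx, ·⟩) (⟨hx, ·⟩)) with h | h
  · refine Or.inl ⟨fun x => (P x).2⁻¹ • (P x).1, fun K hKΩ hK => ?_⟩
    obtain ⟨c, hc, hcK⟩ := hK.exists_forall_le' (f := fun x => (P x).2) (a := 0)
      (continuous_snd.comp_continuousOn (hP.mono hKΩ))
      fun x hx => lt_of_le_of_ne (hPS x (hKΩ hx)).2.1.1 (h (hKΩ hx)).2.symm
    set Q : Set (ℂ × ℝ) := sphereModel ∩ {y | c / 2 ≤ y.2}
    have hU : UniformContinuousOn (fun y : ℂ × ℝ => y.2⁻¹ • y.1) Q := by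
      refine (isCompact_sphereModel.inter_right
        (isClosed_le continuous_const continuous_snd)).uniformContinuousOn_of_continuous ?_
      refine (continuousOn_snd.inv₀ fun y hy => ?_).smul continuousOn_fst
      have : c / 2 ≤ y.2 := hy.2
      linarith
    have hlimK := hlim K hKΩ hK
    have hhalf : ∀ᶠ j in atTop, ∀ x ∈ K, c / 2 ≤ (sphereEmbedding (F (k j) x)).2 := by
      filter_upwards [Metric.tendstoUniformlyOn_iff.1 hlimK (c / 2) (by linarith)] with j hj x hx
      have h1 := (abs_snd_sub_snd_le_dist _ _).trans_lt (hj x hx)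
      linarith [(abs_lt.1 h1).2, hcK x hx]
    have h := UniformContinuousOn.comp_tendstoUniformlyOn_eventually (s := Q)
      (F := fun j x => sphereEmbedding (F (k j) x)) (f := P) (p := atTop) (t := K)
      (hhalf.mono fun j hj x hx => ⟨sphereEmbedding_mem_sphereModel _, hj x hx⟩)
      (fun x hx => ⟨hPS x (hKΩ hx), by
        have := hcK x hx
        change c / 2 ≤ (P x).2
        linarith⟩) hU hlimK
    simpa only [sphereEmbedding_snd_inv_smul_fst] using h
  · refine Or.inr fun K hKΩ hK B => ?_
    have hB : 0 < 1 + B ^ 2 := by positivity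
    -- Second coordinate below 1/(1 + B²) means |F|² > B².
    filter_upwards [Metric.tendstoUniformlyOn_iff.1 (hlim K hKΩ hK) (1 + B ^ 2)⁻¹
      (inv_pos.2 hB)] with j hj x hx
    have h1 := (abs_snd_sub_snd_le_dist _ _).trans_lt (hj x hx)
    rw [(h (hKΩ hx)).2, zero_sub, abs_neg] at h1
    have h2 := (le_abs_self _).trans_lt h1
    have h3 := (inv_lt_inv₀ (one_add_norm_sq_pos _) hB).1 h2
    exact lt_of_pow_lt_pow_left₀ 2 (norm_nonneg _) (by linarith)

end Marty

/-! ### Schwarz-Pick and the spherical derivative of f∘g. -/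

section NormalFunctions

variable {n : ℕ} {z : Cn n}

/-- The Schwarz-Pick lemma for the Bergman metric of the ball. -/
theorem bergmanMetric_fderiv_le {g : Cn n → Cn n} (hg : DifferentiableOn ℂ g (unitBall n))
    (hmaps : MapsTo g (unitBall n) (unitBall n)) (hz : z ∈ unitBall n) (v : Cn n) :
    bergmanMetric (unitBall n) (g z) (fderiv ℂ g z v)
      ≤ (n + 1) * (‖v‖ / (1 - ‖z‖)) ^ 2 := by
  have hz1 : 0 < 1 - ‖z‖ := sub_pos.2 (mem_unitBall.1 hz)
  have hgz := hmaps hz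
  have hgz' : ‖-g z‖ < 1 := by rw [norm_neg]; exact mem_unitBall.1 hgz
  have hA := differentiableOn_ballMobius hgz'
  have hsub : Metric.ball z (1 - ‖z‖) ⊆ unitBall n := by
    refine Metric.ball_subset_ball' ?_
    rw [dist_zero_right]
    linarith
  have h0 := ballMobius_neg_self (mem_unitBall.1 hgz)
  -- The composite maps the ball of radius 1 - ‖z‖ about `z` into the unit ball and sends `z` to 0,
  -- so the Schwarz estimate applies.
  have h1 : ‖fderiv ℂ (ballMobius (-g z) ∘ g) z‖ ≤ 1 / (1 - ‖z‖) := by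
    refine Complex.norm_fderiv_le_div_of_mapsTo_ball ((hA.comp hg hmaps).mono hsub)
      (fun x hx => ?_) hz1
    rw [Function.comp_apply, Function.comp_apply, h0]
    exact Metric.ball_subset_closedBall (mem_ball_zero_iff.2
      (norm_ballMobius_lt_one hgz' (mem_unitBall.1 (hmaps (hsub hx)))))
  rw [fderiv_comp z (hA.differentiableAt (isOpen_unitBall.mem_nhds hgz))
    (hg.differentiableAt (isOpen_unitBall.mem_nhds hz))] at h1
  rw [bergmanMetric_unitBall hgz, ← norm_fderiv_ballMobius_neg_self_sq (mem_unitBall.1 hgz)]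
  gcongr
  refine (ContinuousLinearMap.le_of_opNorm_le _ h1 v).trans_eq ?_
  ring

theorem bergmanMetric_nonneg (hz : z ∈ unitBall n) (v : Cn n) :
    0 ≤ bergmanMetric (unitBall n) z v := by
  have : 0 < 1 - ‖z‖ ^ 2 := by nlinarith [norm_nonneg z, mem_unitBall.1 hz]
  rw [bergmanMetric_unitBall hz]
  positivity

theorem leviForm_log_one_add_norm_sq {U : Set (Cn n)} (hU : IsOpen U) {f : Cn n → ℂ}
    (hf : DifferentiableOn ℂ f U) (hz : z ∈ U) (v : Cn n) :
    leviForm (fun w => Real.log (1 + ‖f w‖ ^ 2)) z v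
      = (‖fderiv ℂ f z v‖ / (1 + ‖f z‖ ^ 2)) ^ 2 := by
  have h := leviForm_log_one_add_mul_sum hU (u := fun _ : Fin 1 => f) (fun _ => hf) 1
    (fun x _ => by positivity) hz v
  have h0 := one_add_norm_sq_pos (f z)
  simp only [one_mul, Finset.univ_unique, Finset.sum_singleton, norm_mul, RCLike.norm_conj,
    one_pow] at h
  rw [h]
  field_simp
  ring

/-- The bound depends on `z` and `C` but not on `g`, which is the uniformity that Marty's criterion
asks for. `max C 0` keeps the square root meaningful for negative `C`. -/
theorem norm_fderiv_comp_le {f : Cn n → ℂ} (hf : DifferentiableOn ℂ f (unitBall n)) {C : ℝ}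
    (hC : ∀ z ∈ unitBall n, ∀ v : Cn n,
      leviForm (fun w => Real.log (1 + ‖f w‖ ^ 2)) z v ≤ C * bergmanMetric (unitBall n) z v)
    {g : Cn n → Cn n} (hg : DifferentiableOn ℂ g (unitBall n))
    (hmaps : MapsTo g (unitBall n) (unitBall n)) (hz : z ∈ unitBall n) :
    ‖fderiv ℂ (f ∘ g) z‖
      ≤ √(max C 0 * (n + 1)) / (1 - ‖z‖) * (1 + ‖(f ∘ g) z‖ ^ 2) := by
  have hz1 : 0 < 1 - ‖z‖ := sub_pos.2 (mem_unitBall.1 hz)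
  have h0 := one_add_norm_sq_pos (f (g z))
  refine ContinuousLinearMap.opNorm_le_bound _ (by positivity) fun v => ?_
  rw [fderiv_comp z (hf.differentiableAt (isOpen_unitBall.mem_nhds (hmaps hz)))
    (hg.differentiableAt (isOpen_unitBall.mem_nhds hz)), ContinuousLinearMap.comp_apply,
    Function.comp_apply]
  have h1 := hC (g z) (hmaps hz) (fderiv ℂ g z v)
  rw [leviForm_log_one_add_norm_sq isOpen_unitBall hf (hmaps hz)] at h1
  have h2 : (‖fderiv ℂ f (g z) (fderiv ℂ g z v)‖ / (1 + ‖f (g z)‖ ^ 2)) ^ 2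
      ≤ (√(max C 0 * (n + 1)) * (‖v‖ / (1 - ‖z‖))) ^ 2 := by
    rw [mul_pow, Real.sq_sqrt (by positivity), mul_assoc]
    refine h1.trans ((mul_le_mul_of_nonneg_right (le_max_left C 0)
      (bergmanMetric_nonneg (hmaps hz) _)).trans ?_)
    exact mul_le_mul_of_nonneg_left (bergmanMetric_fderiv_le hg hmaps hz v) (le_max_right C 0)
  have h3 := (abs_le_of_sq_le_sq' h2 (by positivity)).2
  rw [div_le_iff₀ h0] at h3
  refine h3.trans_eq ?_
  ring

end NormalFunctions

theorem mainTheorem5 (n : ℕ) (f : Cn n → ℂ) (hf : DifferentiableOn ℂ f (unitBall n)) (C : ℝ)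
    (hC : ∀ z ∈ unitBall n, ∀ v : Cn n,
      leviForm (fun w => Real.log (1 + ‖f w‖ ^ 2)) z v ≤ C * bergmanMetric (unitBall n) z v) :
    IsNormalFunction f := by
  refine ⟨hf, ?_, fun u hu => ?_⟩
  · rintro _ ⟨g, hg, rfl⟩
    exact hf.comp hg.1 hg.2.mapsTo
  choose g hg hug using hu
  -- On the ball of radius (1 - ‖x‖)/2 about `x` one has 1 - ‖y‖ ≥ (1 - ‖x‖)/2, so the pointwise
  -- bound becomes a constant there.
  have hr : ∀ x ∈ unitBall n, 0 < (1 - ‖x‖) / 2 := fun x hx =>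
    half_pos (sub_pos.2 (mem_unitBall.1 hx))
  have hdist : ∀ x : Cn n, ∀ y ∈ Metric.ball x ((1 - ‖x‖) / 2), (1 - ‖x‖) / 2 ≤ 1 - ‖y‖ := by
    intro x y hy
    have := norm_sub_norm_le y x
    rw [mem_ball_iff_norm] at hy
    linarith
  have hball : ∀ x ∈ unitBall n, Metric.ball x ((1 - ‖x‖) / 2) ⊆ unitBall n := fun x hx y hy =>
    mem_unitBall.2 (by linarith [hdist x y hy, hr x hx])
  refine exists_subseq_of_spherical_derivative_le isOpen_unitBall
    (convex_ball 0 1).isPreconnected (r := fun x => (1 - ‖x‖) / 2)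
    (M := fun x => √(max C 0 * (n + 1)) / ((1 - ‖x‖) / 2)) (fun j => ?_) hr hball
    fun j x hx y hy => ?_
  · rw [hug j]
    exact hf.comp (hg j).1 (hg j).2.mapsTo
  · rw [hug j]
    refine (norm_fderiv_comp_le hf hC (hg j).1 (hg j).2.mapsTo (hball x hx hy)).trans ?_
    have := hr x hx
    have := hdist x y hy
    gcongr
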